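/- Consider a finite Miura-ori crease pattern, formed by $\ell\ge 1$ equally spaced parallel fold lines crossed by $k\ge 1$ zigzag paths that divide the paper into a $(k+1)\times(\ell+1)$ array of equal parallelograms (faces), reflected across each fold line. A mountain-valley (MV) assignment $\mu$ gives each crease in the interior of the paper the value $+1$ (mountain) or $-1$ (valley). It is locally valid if at every vertex in the interior of the paper three creases have one type and the fourth has the other type and, whenever two of the three creases of equal type belong to the zigzag path, the third one is the crease on the parallel line that is farther, by angle, from these two. Flipping a face negates $\mu$ on exactly the creases bordering that face. A flip sequence from $\mu$ to $\nu$ is a list of faces whose successive flips turn $\mu$ into $\nu$, all assignments on the way being locally valid. (1) There is an algorithm (a single program for a random access machine with unit-cost addition and subtraction) which, given $k$, $\ell$, the side to which the zigzags lean at the first fold line, and any two locally valid MV assignments $\mu,\nu$ of the Miura-ori, outputs a minimum-length flip sequence from $\mu$ to $\nu$ in time polynomial in the length of the input; in particular such a sequence always exists. (2) Let $\mu$ be locally valid. Say that a proper coloring of the faces (as vertices of the dual grid graph) by $\mathbb Z/3$ corresponds to $\mu$ if the color increases by $\mu(e)$ modulo 3 across every crease $e$, where creases on the parallel lines are crossed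 upwards and zigzag creases are crossed horizontally, in directions that alternate from row to row, the direction in the bottom row being the one to which the zigzag creases lean at the vertices of the first fold line. A height function of $\mu$ is an integer function on the faces that is congruent modulo 3 to such a coloring and differs by exactly $\pm1$ between adjacent faces. Every locally valid $\mu$ has a height function. If $f$ and $g$ are height functions of locally valid $\mu$ and $\nu$, then the minimum length of a flip sequence from $\mu$ to $\nu$ is $$\min_t\ \frac12\sum_{F}\,\bigl|f(F)-(g(F)+t)\bigr|,$$ the minimum being over the integers $t$ such that $f(F)-(g(F)+t)$ is even for every face $F$. For every face $F_0$, this minimum is attained by such a $t$ with $|t-(f(F_0)-g(F_0))|\le 2(k+\ell)$, so only linearly many translations have to be considered. -/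

import Mathlib

noncomputable section

namespace MiuraFlip

open scoped BigOperators

/-! ### The Miura-ori crease pattern -/

/-- A finite Miura-ori: `lines ≥ 1` equally spaced parallel (horizontal) fold lines crossed by
`zigzags ≥ 1` zigzag paths, dividing the paper into `(zigzags + 1) × (lines + 1)` equal
parallelograms.  Parallelograms have a horizontal side of length `width`, height `height`, and
their slanted side is displaced horizontally by `shift` or `-shift`, alternately. -/
structure Miura where
  zigzags : ℕ
  lines : ℕ
  zigzags_pos : 1 ≤ zigzags
  lines_pos : 1 ≤ lines
  width : ℝ
  height : ℝ
  shift : ℝ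
  width_pos : 0 < width
  height_pos : 0 < height
  shift_ne : shift ≠ 0

namespace Miura

variable (P : Miura)

/-- The point number `x` (from the left) on the horizontal line number `y` (from below).  The
horizontal lines `1, …, lines` are the fold lines and the lines `0`, `lines + 1` are boundary of the
paper; likewise the points with `x = 1, …, zigzags` lie on zigzag folds, and those with
`x = 0`, `x = zigzags + 1` lie on the boundary. -/
def point (x y : ℕ) : EuclideanSpace ℝ (Fin 2) :=
  !₂[P.width * x + (if Even y then 0 else P.shift), P.height * y]

/-- The face `(i, j)` is the parallelogram with corners
`point i j`, `point (i+1) j`, `point i (j+1)`, `point (i+1) (j+1)`. -/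
abbrev Face : Type := Fin (P.zigzags + 1) × Fin (P.lines + 1)

/-- The creases, i.e. the edges that are not on the boundary of the paper. -/
inductive Crease : Type
  /-- the segment from `point (i+1) j` to `point (i+1) (j+1)`, on a zigzag path -/
  | zig (i : Fin P.zigzags) (j : Fin (P.lines + 1)) : Crease
  /-- the segment from `point i (j+1)` to `point (i+1) (j+1)`, on a parallel line -/
  | line (i : Fin (P.zigzags + 1)) (j : Fin P.lines) : Crease

/-- A mountain-valley assignment: `1` is mountain and `-1` is valley. -/
abbrev MV : Type := P.Crease → ℤˣ

variable {P}

/-- The crease `e` borders the face `F`. -/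
def Borders (F : P.Face) : P.Crease → Prop
  | .zig i j => F.2 = j ∧ (F.1 = i.castSucc ∨ F.1 = i.succ)
  | .line i j => F.1 = i ∧ (F.2 = j.castSucc ∨ F.2 = j.succ)

open Classical in
/-- The face flip: reverse exactly the creases that border `F`. -/
def flip (F : P.Face) (μ : P.MV) : P.MV := fun e => if Borders F e then -μ e else μ e

/-- Local validity at the vertex `point (i+1) (j+1)`: three folds of one type and one of the other
type, and if two of the three come from the zigzag path, then the third one is the edge of the
parallel line that is farther, by angle, from these two. -/
def ValidAt (μ : P.MV) (i : Fin P.zigzags) (j : Fin P.lines) : Prop :=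
  let down := μ (.zig i j.castSucc)
  let up := μ (.zig i j.succ)
  let left := μ (.line i.castSucc j)
  let right := μ (.line i.succ j)
  let v := P.point (i + 1) (j + 1)
  let vDown := P.point (i + 1) j
  let vUp := P.point (i + 1) (j + 2)
  let vLeft := P.point i (j + 1)
  let vRight := P.point (i + 2) (j + 1)
  ((down + up + left + right : ℤ) = 2 ∨ (down + up + left + right : ℤ) = -2) ∧
  (down = up → left = up →
    EuclideanGeometry.angle vDown v vRight < EuclideanGeometry.angle vDown v vLeft ∧
    EuclideanGeometry.angle vUp v vRight < EuclideanGeometry.angle vUp v vLeft) ∧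
  (down = up → right = up →
    EuclideanGeometry.angle vDown v vLeft < EuclideanGeometry.angle vDown v vRight ∧
    EuclideanGeometry.angle vUp v vLeft < EuclideanGeometry.angle vUp v vRight)

/-- Validity at every vertex in the interior of the paper. -/
def LocallyValid (μ : P.MV) : Prop := ∀ i j, ValidAt μ i j

/-- Flipping the faces of the list one after the other turns `μ` into `ν`, and every assignment
reached on the way is locally valid. -/
def IsFlipSequence (ν : P.MV) : P.MV → List P.Face → Prop
  | μ, [] => LocallyValid μ ∧ μ = ν
  | μ, F :: l => LocallyValid μ ∧ IsFlipSequence ν (flip F μ) l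

/-- A flip sequence from `μ` to `ν` of minimum length. -/
def IsMinFlipSequence (μ ν : P.MV) (l : List P.Face) : Prop :=
  IsFlipSequence ν μ l ∧ ∀ l' : List P.Face, IsFlipSequence ν μ l' → l.length ≤ l'.length

/-! ### Grid 3-colorings and height functions -/

/-- The dual grid graph, with one vertex in each parallelogram. -/
abbrev grid (P : Miura) : SimpleGraph P.Face :=
  SimpleGraph.pathGraph (P.zigzags + 1) □ SimpleGraph.pathGraph (P.lines + 1)

open Classical in
/-- The horizontal direction (`1` is to the right) in which row `j` of parallelograms is traversed by
the path that runs through the rows from bottom to top, in alternating directions.  The direction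
in the bottom row is that of the leaning of the zigzag edges at the vertices of the first fold line;
this is the corner to start from for which the color rule below is consistent. -/
def rowDirection (P : Miura) (j : ℕ) : ℤ := if (Even j ↔ P.shift < 0) then 1 else -1

/-- The grid 3-coloring `c` corresponds to `μ`: crossing a mountain fold adds one modulo 3 and crossing a
valley fold subtracts one, where zigzag folds are crossed in the direction of their row and folds on
the parallel lines are crossed upwards. -/
def IsColoringOf (μ : P.MV) (c : P.grid.Coloring (ZMod 3)) : Prop :=
  (∀ (i : Fin P.zigzags) (j : Fin (P.lines + 1)),
    c (i.succ, j) = c (i.castSucc, j) + ((P.rowDirection j * (μ (.zig i j) : ℤ) : ℤ) : ZMod 3)) ∧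
  (∀ (i : Fin (P.zigzags + 1)) (j : Fin P.lines),
    c (i, j.succ) = c (i, j.castSucc) + ((μ (.line i j) : ℤ) : ZMod 3))

/-- A height function of a grid 3-coloring: congruent to the color modulo 3, and changing by `±1`
between adjacent grid vertices. -/
def IsHeightOfColoring (c : P.grid.Coloring (ZMod 3)) (f : P.Face → ℤ) : Prop :=
  (∀ v, (f v : ZMod 3) = c v) ∧ ∀ u v, P.grid.Adj u v → |f u - f v| = 1

/-- A height function of a mountain-valley assignment. -/
def IsHeight (μ : P.MV) (f : P.Face → ℤ) : Prop :=
  ∃ c : P.grid.Coloring (ZMod 3), IsColoringOf μ c ∧ IsHeightOfColoring c f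

/-- The total difference of the heights `f` and `g` after translating `g` by `t`. -/
def totalDiff (f g : P.Face → ℤ) (t : ℤ) : ℤ := ∑ v, |f v - (g v + t)|

/-- A flip changes a height by `±2`, so a translation `t` can only be used if `f` and `g + t` have the
same parity everywhere. -/
def Possible (f g : P.Face → ℤ) (t : ℤ) : Prop := ∀ v, Even (f v - (g v + t))

/-! ### Input and output of the algorithmic problem, as lists of words -/

/-- One word for each crease, `1` for mountain and `0` for valley: first the zigzag creases row by
row, then the creases on the parallel lines, line by line. -/
def encodeMV (μ : P.MV) : List ℕ :=
  let bit : ℤˣ → ℕ := fun s => if s = 1 then 1 else 0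
  (List.ofFn fun a : Fin ((P.lines + 1) * P.zigzags) =>
      bit (μ (.zig (finProdFinEquiv.symm a).2 (finProdFinEquiv.symm a).1))) ++
    List.ofFn fun a : Fin (P.lines * (P.zigzags + 1)) =>
      bit (μ (.line (finProdFinEquiv.symm a).2 (finProdFinEquiv.symm a).1))

open Classical in
/-- The input: the crease pattern (its two sizes and the side to which its zigzags lean), followed by
the two mountain-valley assignments. -/
def encodeInput (μ ν : P.MV) : List ℕ :=
  [P.zigzags, P.lines, if P.shift < 0 then 1 else 0] ++ encodeMV μ ++ encodeMV ν

/-- The output: the two coordinates of each face in the list. -/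
def encodeFaces (l : List P.Face) : List ℕ := l.flatMap fun F => [(F.1 : ℕ), (F.2 : ℕ)]

end Miura

end MiuraFlip

/-! ### Random access machines

A structured program for a random access machine with registers, an indirectly addressed memory and
an output tape.  The arithmetic instructions are addition and (truncated) subtraction only, so
that numbers grow by at most one bit per step and polynomially many unit-cost steps amount to
polynomial time on a Turing machine. -/

namespace RAM

/-- Programs. -/
inductive Prog : Type
  /-- `r[x] := k` -/
  | const (x k : ℕ) : Prog
  /-- `r[x] := r[y] + r[z]` -/
  | add (x y z : ℕ) : Prog
  /-- `r[x] := r[y] - r[z]`, or `0` if this is negative -/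
  | sub (x y z : ℕ) : Prog
  /-- `r[x] := mem[r[y]]` -/
  | load (x y : ℕ) : Prog
  /-- `mem[r[x]] := r[y]` -/
  | store (x y : ℕ) : Prog
  /-- write `r[x]` on the output tape -/
  | emit (x : ℕ) : Prog
  /-- first `p`, then `q` -/
  | seq (p q : Prog) : Prog
  /-- if `r[x] ≠ 0` then `p` else `q` -/
  | cond (x : ℕ) (p q : Prog) : Prog
  /-- while `r[x] ≠ 0` do `p` -/
  | loop (x : ℕ) (p : Prog) : Prog

/-- Machine states. -/
structure State where
  reg : ℕ → ℕ
  mem : ℕ → ℕ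
  out : List ℕ

/-- The initial state: the input is in the memory cells `0, 1, 2, …`, and everything else is `0`. -/
def start (input : List ℕ) : State where
  reg := fun _ => 0
  mem := fun a => input.getD a 0
  out := []

/-- `Runs p s t s'`: started in the state `s`, the program `p` halts after exactly `t` steps, in the
state `s'`.  Each instruction and each test of a register costs one step. -/
inductive Runs : Prog → State → ℕ → State → Prop
  | const (x k : ℕ) (s : State) :
      Runs (.const x k) s 1 { s with reg := Function.update s.reg x k }
  | add (x y z : ℕ) (s : State) :
      Runs (.add x y z) s 1 { s with reg := Function.update s.reg x (s.reg y + s.reg z) }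
  | sub (x y z : ℕ) (s : State) :
      Runs (.sub x y z) s 1 { s with reg := Function.update s.reg x (s.reg y - s.reg z) }
  | load (x y : ℕ) (s : State) :
      Runs (.load x y) s 1 { s with reg := Function.update s.reg x (s.mem (s.reg y)) }
  | store (x y : ℕ) (s : State) :
      Runs (.store x y) s 1 { s with mem := Function.update s.mem (s.reg x) (s.reg y) }
  | emit (x : ℕ) (s : State) :
      Runs (.emit x) s 1 { s with out := s.out ++ [s.reg x] }
  | seq {p q : Prog} {s s' s'' : State} {t t' : ℕ} :
      Runs p s t s' → Runs q s' t' s'' → Runs (.seq p q) s (t + t') s''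
  | cond_true {x : ℕ} {p q : Prog} {s s' : State} {t : ℕ} :
      s.reg x ≠ 0 → Runs p s t s' → Runs (.cond x p q) s (t + 1) s'
  | cond_false {x : ℕ} {p q : Prog} {s s' : State} {t : ℕ} :
      s.reg x = 0 → Runs q s t s' → Runs (.cond x p q) s (t + 1) s'
  | loop_done {x : ℕ} {p : Prog} {s : State} :
      s.reg x = 0 → Runs (.loop x p) s 1 s
  | loop_step {x : ℕ} {p : Prog} {s s' s'' : State} {t t' : ℕ} :
      s.reg x ≠ 0 → Runs p s t s' → Runs (.loop x p) s' t' s'' →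
      Runs (.loop x p) s (t + t' + 1) s''

/-- On the given input, the program halts after at most `T` steps and has then written `output`. -/
def ComputesWithin (p : Prog) (input : List ℕ) (T : ℕ) (output : List ℕ) : Prop :=
  ∃ (t : ℕ) (s : State), Runs p (start input) t s ∧ t ≤ T ∧ s.out = output

end RAM

end

namespace MiuraFlip.Miura

open scoped BigOperators

variable {P : Miura}

/-! ### Local validity as a closed form condition -/

/-! Local validity at a vertex is a single linear equation (`validAt_iff`): the signed crease values
on a loop around the vertex sum to zero, the signs coming from the alternating row directions. So a
locally valid assignment is a discrete gradient. It has an integer potential on the faces, unique up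
to a constant, and potentials are the same as height functions (`isHeight_iff`), because a step of
`±1` is determined by its residue modulo 3.

In terms of a potential, a flip keeps validity exactly when the face is a local extremum, and then
it moves that height by `±2` (`IsPotential.extremum_of_flip`, `IsPotential.flip_extremum`). A flip
sequence from `μ` to `ν` therefore lifts to a walk from `f` to some translate `g + t` of the same
parity, and each flip lowers the total difference by at most two (`IsFlipSequence.exists_lift`).
Conversely, among the faces where `f > g + t` a highest one is a local maximum, and dually for `f <
g + t`, so some flip always gains two (`IsPotential.flip_toward`, `exists_isFlipSequence`). An
optimal `t` lies between the extreme values of `f - g`, since otherwise a shift by two would improve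
it. As `f - g` varies by at most two across a crease, only a linear window of translations matters.

The program tabulates both heights, tries every translation in a window containing this one, and
then sweeps once through the levels, flipping on each level the faces that are too high and,
mirrored, those that are too low. The inductive relation `Sweep` separates the machine
(`sweep_spec`) from the geometry (`sweep_invariant`). -/

theorem rowDirection_succ (P : Miura) (j : ℕ) : P.rowDirection (j + 1) = -P.rowDirection j := by
  unfold rowDirection
  by_cases h : Even j <;> by_cases h' : P.shift < 0 <;> simp [h, h', Nat.even_add_one]

theorem rowDirection_eq (P : Miura) (j : ℕ) :
    P.rowDirection j = 1 ∨ P.rowDirection j = -1 := by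
  unfold rowDirection
  split_ifs <;> simp

/-- The two angles are supplementary, so the comparison asks whether the first one is acute. -/
theorem angle_lt_angle_neg_iff (x y : EuclideanSpace ℝ (Fin 2)) (hx : x ≠ 0) (hy : y ≠ 0) :
    InnerProductGeometry.angle x y < InnerProductGeometry.angle x (-y) ↔ 0 < inner ℝ x y := by
  rw [InnerProductGeometry.angle_neg_right]
  have : InnerProductGeometry.angle x y < Real.pi / 2 ↔ 0 < inner ℝ x y := by
    rw [InnerProductGeometry.angle, Real.arccos_lt_pi_div_two]
    exact div_pos_iff_of_pos_right (by positivity)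
  rw [← this]
  constructor <;> intro h <;> linarith

theorem angle_neg_lt_angle_iff (x y : EuclideanSpace ℝ (Fin 2)) (hx : x ≠ 0) (hy : y ≠ 0) :
    InnerProductGeometry.angle x (-y) < InnerProductGeometry.angle x y ↔ inner ℝ x y < 0 := by
  have := angle_lt_angle_neg_iff x (-y) hx (neg_ne_zero.2 hy)
  rw [neg_neg, inner_neg_right] at this
  rw [this]
  constructor <;> intro h <;> linarith

theorem angle_comparisons (a h w : ℝ) (hh : h ≠ 0) (hw : 0 < w)
    (v d r l : EuclideanSpace ℝ (Fin 2)) (hd : d -ᵥ v = !₂[a, h]) (hr : r -ᵥ v = !₂[w, 0])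
    (hl : l -ᵥ v = !₂[-w, 0]) :
    (EuclideanGeometry.angle d v r < EuclideanGeometry.angle d v l ↔ 0 < a) ∧
    (EuclideanGeometry.angle d v l < EuclideanGeometry.angle d v r ↔ a < 0) := by
  have hl' : l -ᵥ v = -(r -ᵥ v) := by
    rw [hl, hr]
    ext i
    fin_cases i <;> simp
  have hin : inner ℝ (d -ᵥ v) (r -ᵥ v) = w * a := by
    rw [hd, hr]
    simp [PiLp.inner_apply, Fin.sum_univ_two]
  have hd0 : d -ᵥ v ≠ 0 := by
    rw [hd]
    intro h0
    exact hh (by simpa using congrArg (fun z : EuclideanSpace ℝ (Fin 2) => z 1) h0)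
  have hr0 : r -ᵥ v ≠ 0 := by
    rw [hr]
    intro h0
    exact hw.ne' (by simpa using congrArg (fun z : EuclideanSpace ℝ (Fin 2) => z 0) h0)
  unfold EuclideanGeometry.angle
  rw [hl', angle_lt_angle_neg_iff _ _ hd0 hr0, angle_neg_lt_angle_iff _ _ hd0 hr0, hin]
  exact ⟨mul_pos_iff_of_pos_left hw,
    by rw [← neg_pos, ← mul_neg, mul_pos_iff_of_pos_left hw, neg_pos]⟩

/-- Both zigzag neighbours of a vertex are displaced to the same side, so one offset `a` serves
above and below; its sign is what `rowDirection` encodes. -/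
theorem exists_lean (P : Miura) (j : ℕ) : ∃ a : ℝ,
    (0 < a ↔ P.rowDirection j = 1) ∧ (a < 0 ↔ P.rowDirection j = -1) ∧
    ∀ x : ℕ, P.point x j -ᵥ P.point x (j + 1) = !₂[a, -P.height] ∧
      P.point x (j + 2) -ᵥ P.point x (j + 1) = !₂[a, P.height] := by
  have hne := P.shift_ne
  by_cases h : Even j
  · refine ⟨-P.shift, ?_, ?_, fun x => ⟨?_, ?_⟩⟩
    · simp [rowDirection, h]
    · simp only [rowDirection, h, true_iff]
      split_ifs with h' <;> simp
      · exact h'.le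
      · exact lt_of_le_of_ne (not_lt.1 h') hne.symm
    · ext i
      fin_cases i <;> simp [point, h, Nat.even_add_one]
      ring
    · ext i
      fin_cases i <;> simp [point, h, Nat.even_add_one]
      ring
  · refine ⟨P.shift, ?_, ?_, fun x => ⟨?_, ?_⟩⟩
    · simp only [rowDirection, h, false_iff, not_lt]
      split_ifs with h' <;> simp
      · exact lt_of_le_of_ne h' hne.symm
      · exact (not_le.1 h').le
    · simp only [rowDirection, h, false_iff, not_lt]
      split_ifs with h' <;> simp
      · exact h'
      · exact not_le.1 h'
    · ext i
      fin_cases i <;> simp [point, h, Nat.even_add_one]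
      ring
    · ext i
      fin_cases i <;> simp [point, h, Nat.even_add_one]
      ring

/-- The right side is the total change on a loop around the vertex. The loop crosses the upper row
backwards, but row directions alternate, so both zigzag creases enter with the same sign. Once the
angles are replaced by the sign of the lean, finitely many cases remain. -/
theorem validAt_iff (μ : P.MV) (i : Fin P.zigzags) (j : Fin P.lines) :
    ValidAt μ i j ↔
      P.rowDirection j * ((μ (.zig i j.castSucc) : ℤ) + (μ (.zig i j.succ) : ℤ)) +
        (μ (.line i.succ j) : ℤ) - (μ (.line i.castSucc j) : ℤ) = 0 := by
  obtain ⟨a, hpos, hneg, hv⟩ := exists_lean P j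
  have hr : P.point (i + 2) (j + 1) -ᵥ P.point (i + 1) (j + 1) = !₂[P.width, 0] := by
    ext i
    fin_cases i <;> simp [point]
    ring
  have hl : P.point i (j + 1) -ᵥ P.point (i + 1) (j + 1) = !₂[-P.width, 0] := by
    ext i
    fin_cases i <;> simp [point]
    ring
  obtain ⟨h1, h2⟩ := angle_comparisons a (-P.height) P.width (neg_ne_zero.2 P.height_pos.ne')
    P.width_pos _ _ _ _ (hv (i + 1)).1 hr hl
  obtain ⟨h3, h4⟩ := angle_comparisons a P.height P.width P.height_pos.ne'
    P.width_pos _ _ _ _ (hv (i + 1)).2 hr hl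
  simp only [ValidAt, h1, h2, h3, h4, hpos, hneg, and_self]
  generalize μ (.zig i j.castSucc) = d
  generalize μ (.zig i j.succ) = u
  generalize μ (.line i.succ j) = r
  generalize μ (.line i.castSucc j) = l
  rcases rowDirection_eq P j with h | h <;> rw [h] <;> revert d u r l <;> decide

/-! ### Height functions -/

/-- The integer function `f` on the faces changes across each crease by its sign. -/
def IsPotential (μ : P.MV) (f : P.Face → ℤ) : Prop :=
  (∀ (i : Fin P.zigzags) (j : Fin (P.lines + 1)),
    f (i.succ, j) = f (i.castSucc, j) + P.rowDirection j * (μ (.zig i j) : ℤ)) ∧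
  (∀ (i : Fin (P.zigzags + 1)) (j : Fin P.lines),
    f (i, j.succ) = f (i, j.castSucc) + (μ (.line i j) : ℤ))

theorem grid_induction {p : P.Face → P.Face → Prop} (hp : ∀ u v, p u v → p v u)
    (h1 : ∀ (i : Fin P.zigzags) (j : Fin (P.lines + 1)), p (i.castSucc, j) (i.succ, j))
    (h2 : ∀ (i : Fin (P.zigzags + 1)) (j : Fin P.lines), p (i, j.castSucc) (i, j.succ))
    (u v : P.Face) (h : P.grid.Adj u v) : p u v := by
  have h1' : ∀ (i i' : Fin (P.zigzags + 1)) (j : Fin (P.lines + 1)), (i : ℕ) + 1 = i' →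
      p (i, j) (i', j) := by
    intro i i' j hi
    have := h1 ⟨i, by omega⟩ j
    rwa [show i' = Fin.succ ⟨i, by omega⟩ from Fin.ext hi.symm]
  have h2' : ∀ (i : Fin (P.zigzags + 1)) (j j' : Fin (P.lines + 1)), (j : ℕ) + 1 = j' →
      p (i, j) (i, j') := by
    intro i j j' hi
    have := h2 i ⟨j, by omega⟩
    rwa [show j' = Fin.succ ⟨j, by omega⟩ from Fin.ext hi.symm]
  obtain ⟨a, b⟩ := u
  obtain ⟨c, d⟩ := v
  simp only [SimpleGraph.boxProd_adj, SimpleGraph.pathGraph_adj] at h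
  rcases h with ⟨h | h, rfl⟩ | ⟨h | h, rfl⟩
  · exact h1' _ _ _ h
  · exact hp _ _ (h1' _ _ _ h)
  · exact h2' _ _ _ h
  · exact hp _ _ (h2' _ _ _ h)

theorem adj_zig (i : Fin P.zigzags) (j : Fin (P.lines + 1)) :
    P.grid.Adj (i.castSucc, j) (i.succ, j) := by
  simp [SimpleGraph.boxProd_adj, SimpleGraph.pathGraph_adj]

theorem adj_line (i : Fin (P.zigzags + 1)) (j : Fin P.lines) :
    P.grid.Adj (i, j.castSucc) (i, j.succ) := by
  simp [SimpleGraph.boxProd_adj, SimpleGraph.pathGraph_adj]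

theorem rowDirection_mul_unit (j : ℕ) (s : ℤˣ) :
    P.rowDirection j * (s : ℤ) = 1 ∨ P.rowDirection j * (s : ℤ) = -1 := by
  rcases rowDirection_eq P j with h | h <;> rcases Int.units_eq_one_or s with h' | h' <;>
    simp [h, h']

theorem IsPotential.abs_sub {μ : P.MV} {f : P.Face → ℤ} (hf : IsPotential μ f) (u v : P.Face)
    (h : P.grid.Adj u v) : |f u - f v| = 1 := by
  refine grid_induction (p := fun u v => |f u - f v| = 1) ?_ ?_ ?_ u v h
  · intro u v h
    rwa [abs_sub_comm]
  · intro i j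
    rw [hf.1]
    rcases rowDirection_mul_unit (P := P) j (μ (.zig i j)) with h | h <;> simp [h]
  · intro i j
    rw [hf.2]
    rcases Int.units_eq_one_or (μ (.line i j)) with h | h <;> simp [h]

/-- `1` and `-1` are distinct modulo 3; this is what makes the lift of a coloring to heights rigid.
-/
theorem eq_of_unit_of_cast_eq {a b : ℤ} (ha : |a| = 1) (hb : b = 1 ∨ b = -1)
    (h : (a : ZMod 3) = (b : ZMod 3)) : a = b := by
  rw [ZMod.intCast_eq_intCast_iff_dvd_sub] at h
  rcases (abs_eq (by norm_num)).1 ha with rfl | rfl <;> rcases hb with rfl | rfl <;> revert h <;>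
    decide

theorem isHeight_iff (μ : P.MV) (f : P.Face → ℤ) : IsHeight μ f ↔ IsPotential μ f := by
  constructor
  · rintro ⟨c, ⟨hc1, hc2⟩, hf, hadj⟩
    constructor
    · intro i j
      have h := eq_of_unit_of_cast_eq (hadj _ _ (adj_zig i j).symm)
        (rowDirection_mul_unit (P := P) j (μ (.zig i j)))
        (by rw [Int.cast_sub, hf, hf, hc1, add_sub_cancel_left])
      linarith
    · intro i j
      have h := eq_of_unit_of_cast_eq (b := (μ (.line i j) : ℤ)) (hadj _ _ (adj_line i j).symm)
        (by rcases Int.units_eq_one_or (μ (.line i j)) with h | h <;> simp [h])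
        (by rw [Int.cast_sub, hf, hf, hc2, add_sub_cancel_left])
      linarith
  · intro hf
    refine ⟨SimpleGraph.Coloring.mk (fun v => (f v : ZMod 3)) ?_, ⟨?_, ?_⟩, fun v => rfl,
      hf.abs_sub⟩
    · intro u v h heq
      have := hf.abs_sub u v h
      rw [ZMod.intCast_eq_intCast_iff_dvd_sub] at heq
      rcases (abs_eq (by norm_num)).1 this with h | h <;> omega
    · intro i j
      change ((f _ : ℤ) : ZMod 3) = (f _ : ZMod 3) + _
      rw [hf.1, Int.cast_add]
    · intro i j
      change ((f _ : ℤ) : ZMod 3) = (f _ : ZMod 3) + _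
      rw [hf.2, Int.cast_add]

theorem IsPotential.locallyValid {μ : P.MV} {f : P.Face → ℤ} (hf : IsPotential μ f) :
    LocallyValid μ := by
  intro i j
  rw [validAt_iff]
  have h1 := hf.1 i j.castSucc
  have h2 := hf.1 i j.succ
  have h3 := hf.2 i.castSucc j
  have h4 := hf.2 i.succ j
  rw [Fin.val_succ, rowDirection_succ] at h2
  rw [Fin.val_castSucc] at h1
  linarith

/-- The vertex equations carry the vertical increments from each column to the next, so they need to
be prescribed only in the first column. -/
theorem LocallyValid.isPotential {μ : P.MV} (hμ : LocallyValid μ) {f : P.Face → ℤ}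
    (hz : ∀ (i : Fin P.zigzags) (j : Fin (P.lines + 1)),
      f (i.succ, j) = f (i.castSucc, j) + P.rowDirection j * (μ (.zig i j) : ℤ))
    (h0 : ∀ j : Fin P.lines, f (0, j.succ) = f (0, j.castSucc) + (μ (.line 0 j) : ℤ)) :
    IsPotential μ f := by
  refine ⟨hz, fun i j => ?_⟩
  induction i using Fin.induction with
  | zero => exact h0 j
  | succ i ih =>
    have h1 := hz i j.castSucc
    have h2 := hz i j.succ
    have h3 := (validAt_iff μ i j).1 (hμ i j)
    rw [Fin.val_succ, rowDirection_succ] at h2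
    rw [Fin.val_castSucc] at h1
    linarith

theorem LocallyValid.exists_isPotential {μ : P.MV} (hμ : LocallyValid μ) :
    ∃ f, IsPotential μ f := by
  let f0 : Fin (P.lines + 1) → ℤ :=
    Fin.induction (motive := fun _ => ℤ) 0 fun j x => x + (μ (.line 0 j) : ℤ)
  let f : P.Face → ℤ := fun v =>
    Fin.induction (motive := fun _ => ℤ) (f0 v.2)
      (fun i x => x + P.rowDirection v.2 * (μ (.zig i v.2) : ℤ)) v.1
  exact ⟨f, hμ.isPotential (fun i j => Fin.induction_succ ..) fun j =>
    Fin.induction_succ (motive := fun _ => ℤ) (0 : ℤ) (fun j x => x + (μ (.line 0 j) : ℤ)) j⟩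

theorem IsPotential.add_const {μ : P.MV} {f : P.Face → ℤ} (hf : IsPotential μ f) (t : ℤ) :
    IsPotential μ fun v => f v + t :=
  ⟨fun i j => by dsimp only; rw [hf.1]; ring, fun i j => by dsimp only; rw [hf.2]; ring⟩

theorem IsPotential.unique {μ ν : P.MV} {f : P.Face → ℤ} (hf : IsPotential μ f)
    (hg : IsPotential ν f) : μ = ν := by
  funext e
  apply Units.ext
  cases e with
  | zig i j =>
    have h := (hf.1 i j).symm.trans (hg.1 i j)
    rcases rowDirection_eq P j with h' | h' <;> rw [h'] at h <;> linarith
  | line i j => linarith [(hf.2 i j).symm.trans (hg.2 i j)]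

theorem constant_of_adj (h : P.Face → ℤ) (hh : ∀ u v, P.grid.Adj u v → h u = h v)
    (u v : P.Face) : h u = h v := by
  have h1 : ∀ (i : Fin (P.zigzags + 1)) (j : Fin (P.lines + 1)), h (i, j) = h (0, j) := by
    intro i j
    induction i using Fin.induction with
    | zero => rfl
    | succ i ih => rw [← ih, hh _ _ (adj_zig i j)]
  have h2 : ∀ (j : Fin (P.lines + 1)), h (0, j) = h (0, 0) := by
    intro j
    induction j using Fin.induction with
    | zero => rfl
    | succ j ih => rw [← ih, hh _ _ (adj_line 0 j)]
  rw [h1 u.1 u.2, h1 v.1 v.2, h2, h2 v.2]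

theorem IsPotential.eq_add_const {μ : P.MV} {f g : P.Face → ℤ} (hf : IsPotential μ f)
    (hg : IsPotential μ g) (u v : P.Face) : f u - g u = f v - g v := by
  refine constant_of_adj (fun v => f v - g v) (grid_induction (fun _ _ h => h.symm) ?_ ?_) u v
  · intro i j
    linarith [hf.1 i j, hg.1 i j]
  · intro i j
    linarith [hf.2 i j, hg.2 i j]

/-- Both heights change parity across every crease, so one face decides the parity of the difference
everywhere. -/
theorem IsPotential.even_sub_iff {μ ν : P.MV} {f g : P.Face → ℤ} (hf : IsPotential μ f)
    (hg : IsPotential ν g) (t : ℤ) (u : P.Face) (hu : Even (f u - (g u + t))) :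
    Possible f g t := by
  intro v
  have := constant_of_adj (fun v => (f v - (g v + t)) % 2) ?_ u v
  swap
  · intro u v h
    have h1 := hf.abs_sub u v h
    have h2 := hg.abs_sub u v h
    rcases (abs_eq (by norm_num)).1 h1 with h1 | h1 <;>
      rcases (abs_eq (by norm_num)).1 h2 with h2 | h2 <;> omega
  rw [Int.even_iff] at hu ⊢
  omega

/-! ### Flips and height functions -/

theorem borders_zig (F : P.Face) (i : Fin P.zigzags) (j : Fin (P.lines + 1)) :
    Borders F (.zig i j) ↔ (i.castSucc, j) = F ∨ (i.succ, j) = F := by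
  obtain ⟨a, b⟩ := F
  simp only [Borders, Prod.mk.injEq]
  tauto

theorem borders_line (F : P.Face) (i : Fin (P.zigzags + 1)) (j : Fin P.lines) :
    Borders F (.line i j) ↔ (i, j.castSucc) = F ∨ (i, j.succ) = F := by
  obtain ⟨a, b⟩ := F
  simp only [Borders, Prod.mk.injEq]
  tauto

open Classical in
theorem IsPotential.flip_sub {μ : P.MV} {f f' : P.Face → ℤ} {F : P.Face} (hf : IsPotential μ f)
    (hf' : IsPotential (flip F μ) f') (u v : P.Face) (h : P.grid.Adj u v) :
    f' u - f' v = if u = F ∨ v = F then f v - f u else f u - f v := by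
  refine grid_induction
    (p := fun u v => f' u - f' v = if u = F ∨ v = F then f v - f u else f u - f v) ?_ ?_ ?_ u v h
  · intro u v h
    split_ifs at h ⊢ <;> first | linarith | tauto
  · intro i j
    have h1 := hf.1 i j
    have h2 := hf'.1 i j
    simp only [flip, borders_zig] at h2
    split_ifs at h2 ⊢ <;> (try rw [Units.val_neg] at h2) <;> linarith
  · intro i j
    have h1 := hf.2 i j
    have h2 := hf'.2 i j
    simp only [flip, borders_line] at h2
    split_ifs at h2 ⊢ <;> (try rw [Units.val_neg] at h2) <;> linarith

open Classical in
theorem isPotential_flip_of_sub {μ : P.MV} {f f' : P.Face → ℤ} {F : P.Face}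
    (hf : IsPotential μ f) (h : ∀ u v, P.grid.Adj u v →
      f' u - f' v = if u = F ∨ v = F then f v - f u else f u - f v) :
    IsPotential (flip F μ) f' := by
  constructor
  · intro i j
    have h1 := hf.1 i j
    have h2 := h _ _ (adj_zig i j)
    simp only [flip, borders_zig]
    split_ifs at h2 ⊢ <;> (try rw [Units.val_neg]) <;> linarith
  · intro i j
    have h1 := hf.2 i j
    have h2 := h _ _ (adj_line i j)
    simp only [flip, borders_line]
    split_ifs at h2 ⊢ <;> (try rw [Units.val_neg]) <;> linarith

/-- Reflecting the value at `F` in the common value of its neighbours negates exactly the increments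
at `F`. -/
theorem IsPotential.flip_extremum {μ : P.MV} {f : P.Face → ℤ} {F : P.Face} {ε : ℤ}
    (hf : IsPotential μ f) (h : ∀ u, P.grid.Adj F u → f u = f F + ε) :
    IsPotential (flip F μ) (Function.update f F (f F + 2 * ε)) := by
  classical
  apply isPotential_flip_of_sub hf
  intro u v huv
  by_cases hu : u = F
  · subst hu
    rw [Function.update_self, Function.update_of_ne huv.ne', if_pos (Or.inl rfl), h v huv]
    ring
  · by_cases hv : v = F
    · subst hv
      rw [Function.update_self, Function.update_of_ne hu, if_pos (Or.inr rfl), h u huv.symm]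
      ring
    · rw [Function.update_of_ne hu, Function.update_of_ne hv, if_neg (by tauto)]

theorem exists_adj_of_one_le {n : ℕ} (hn : 1 ≤ n) (i : Fin (n + 1)) :
    ∃ i', (SimpleGraph.pathGraph (n + 1)).Adj i i' := by
  rcases Nat.eq_zero_or_pos i with h | h
  · exact ⟨⟨1, by omega⟩, by simp [SimpleGraph.pathGraph_adj, h]⟩
  · exact ⟨⟨i - 1, by omega⟩, by simp only [SimpleGraph.pathGraph_adj]; omega⟩

/-- Adding the increments of `f'` around a 4-cycle through `F` forces a horizontal and a vertical
neighbour of `F` to have equal height. Since `F` has neighbours of both kinds, all of them agree. -/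
theorem IsPotential.extremum_of_flip {μ : P.MV} {f f' : P.Face → ℤ} {F : P.Face}
    (hf : IsPotential μ f) (hf' : IsPotential (flip F μ) f') :
    ∃ ε : ℤ, (ε = 1 ∨ ε = -1) ∧ ∀ u, P.grid.Adj F u → f u = f F + ε := by
  classical
  obtain ⟨i, j⟩ := F
  have key : ∀ i' j', (SimpleGraph.pathGraph (P.zigzags + 1)).Adj i i' →
      (SimpleGraph.pathGraph (P.lines + 1)).Adj j j' → f (i', j) = f (i, j') := by
    intro i' j' hi hj
    have h1 := hf.flip_sub hf' (i, j) (i', j) (Or.inl ⟨hi, rfl⟩)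
    have h2 := hf.flip_sub hf' (i', j) (i', j') (Or.inr ⟨hj, rfl⟩)
    have h3 := hf.flip_sub hf' (i', j') (i, j') (Or.inl ⟨hi.symm, rfl⟩)
    have h4 := hf.flip_sub hf' (i, j') (i, j) (Or.inr ⟨hj.symm, rfl⟩)
    simp [hi.ne', hj.ne'] at h1 h2 h3 h4
    linarith
  obtain ⟨i₀, hi₀⟩ := exists_adj_of_one_le P.zigzags_pos i
  obtain ⟨j₀, hj₀⟩ := exists_adj_of_one_le P.lines_pos j
  refine ⟨f (i₀, j) - f (i, j), ?_, ?_⟩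
  · have := hf.abs_sub (i₀, j) (i, j) (Or.inl ⟨hi₀.symm, rfl⟩)
    exact (abs_eq (by norm_num)).1 this
  · rintro ⟨i', j'⟩ (⟨h, h'⟩ | ⟨h, h'⟩)
    · dsimp only at h h'
      subst h'
      linarith [key i' j₀ h hj₀, key i₀ j₀ hi₀ hj₀]
    · dsimp only at h h'
      subst h'
      linarith [key i₀ j' hi₀ h]

theorem IsPotential.lift_flip {μ : P.MV} {f : P.Face → ℤ} {F : P.Face} (hf : IsPotential μ f)
    (h : LocallyValid (flip F μ)) : ∃ ε : ℤ, (ε = 1 ∨ ε = -1) ∧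
      IsPotential (flip F μ) (Function.update f F (f F + 2 * ε)) := by
  obtain ⟨f', hf'⟩ := h.exists_isPotential
  obtain ⟨ε, hε, h⟩ := hf.extremum_of_flip hf'
  exact ⟨ε, hε, hf.flip_extremum h⟩

/-! ### Flip sequences as walks between height functions -/

theorem IsFlipSequence.locallyValid_left {μ ν : P.MV} {l : List P.Face}
    (h : IsFlipSequence ν μ l) : LocallyValid μ := by
  cases l <;> exact h.1

theorem IsFlipSequence.append {μ ν : P.MV} {l : List P.Face} (h : IsFlipSequence ν μ l)
    {F : P.Face} (hF : LocallyValid (flip F ν)) : IsFlipSequence (flip F ν) μ (l ++ [F]) := by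
  induction l generalizing μ with
  | nil =>
    obtain ⟨h, rfl⟩ := h
    exact ⟨h, hF, rfl⟩
  | cons G l ih => exact ⟨h.1, ih h.2⟩

theorem sum_update_add (f g : P.Face → ℤ) (F : P.Face) (x : ℤ) :
    ∑ v, |Function.update f F x v - g v| + |f F - g F| = ∑ v, |f v - g v| + |x - g F| := by
  rw [← Finset.add_sum_erase _ _ (Finset.mem_univ F), Function.update_self,
    ← Finset.add_sum_erase Finset.univ (fun v => |f v - g v|) (Finset.mem_univ F)]
  rw [Finset.sum_congr rfl (g := fun v => |f v - g v|)]
  · ring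
  · intro v hv
    rw [Function.update_of_ne (Finset.ne_of_mem_erase hv)]

/-- Each lifted flip moves one height by `±2`, which keeps parities and changes the total difference
by at most two. This is the source of the lower bound on the length. -/
theorem IsFlipSequence.exists_lift {μ ν : P.MV} {l : List P.Face} {f : P.Face → ℤ}
    (h : IsFlipSequence ν μ l) (hf : IsPotential μ f) :
    ∃ f', IsPotential ν f' ∧ (∀ v, Even (f v - f' v)) ∧ ∑ v, |f v - f' v| ≤ 2 * l.length := by
  induction l generalizing μ f with
  | nil =>
    obtain ⟨-, rfl⟩ := h
    exact ⟨f, hf, by simp, by simp⟩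
  | cons F l ih =>
    obtain ⟨ε, hε, hF⟩ := hf.lift_flip h.2.locallyValid_left
    obtain ⟨f', hf', heven, hsum⟩ := ih h.2 hF
    refine ⟨f', hf', fun v => ?_, ?_⟩
    · have := heven v
      by_cases hv : v = F
      · subst hv
        rw [Function.update_self] at this
        rw [Int.even_iff] at this ⊢
        omega
      · rwa [Function.update_of_ne hv] at this
    · have := sum_update_add f f' F (f F + 2 * ε)
      have habs : |f F - f' F| ≤ |f F + 2 * ε - f' F| + 2 := by
        rcases hε with rfl | rfl <;> simp only [abs_le] <;> constructor <;>
          cases abs_cases (f F + 2 * 1 - f' F) <;> cases abs_cases (f F + 2 * -1 - f' F) <;> omega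
      have h2 : |f F + 2 * ε - f' F| ≤ |f F - f' F| + 2 := by
        rcases hε with rfl | rfl <;> simp only [abs_le] <;> constructor <;>
          cases abs_cases (f F - f' F) <;> omega
      rw [List.length_cons]
      push_cast
      linarith

/-- For `ε = 1` let `u` be a neighbour of `F`. If `f u > g u`, maximality excludes `f u = f F + 1`.
Otherwise `f u ≤ g u ≤ g F + 1 ≤ f F - 1`, the last step because the positive even difference at `F`
is at least two. So `F` is a local maximum, and lowering it does not overshoot. The case `ε = -1` is
the mirror image. -/
theorem IsPotential.flip_toward {μ ν : P.MV} {f g : P.Face → ℤ} (hf : IsPotential μ f)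
    (hg : IsPotential ν g) {ε : ℤ} (hε : ε = 1 ∨ ε = -1) {F : P.Face}
    (heven : ∀ u, Even (f u - g u)) (hF : 0 < ε * (f F - g F))
    (hmax : ∀ u, 0 < ε * (f u - g u) → ε * f u ≤ ε * f F) :
    IsPotential (flip F μ) (Function.update f F (f F - 2 * ε)) ∧
    (∀ u, Even (Function.update f F (f F - 2 * ε) u - g u)) ∧
    ∑ v, |Function.update f F (f F - 2 * ε) v - g v| + 2 = ∑ v, |f v - g v| := by
  have hF2 : 2 ≤ ε * (f F - g F) := by
    obtain ⟨r, hr⟩ := heven F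
    rcases hε with rfl | rfl <;> omega
  refine ⟨?_, fun u => ?_, ?_⟩
  · have := hf.flip_extremum (F := F) (ε := -ε) ?_
    · convert this using 2
      ring
    · intro u hu
      have h1 := hf.abs_sub _ _ hu
      have h2 := hg.abs_sub _ _ hu
      have h3 := hmax u
      rcases hε with rfl | rfl <;> rcases (abs_eq (by norm_num)).1 h1 with h1 | h1 <;>
        rcases (abs_eq (by norm_num)).1 h2 with h2 | h2 <;> omega
  · by_cases hu : u = F
    · subst hu
      rw [Function.update_self]
      have := heven u
      rw [Int.even_iff] at this ⊢
      omega
    · rw [Function.update_of_ne hu]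
      exact heven u
  · have := sum_update_add f g F (f F - 2 * ε)
    have h : |f F - g F| = |f F - 2 * ε - g F| + 2 := by
      rcases hε with rfl | rfl
      · rw [abs_of_nonneg (by omega), abs_of_nonneg (by omega)]
        ring
      · rw [abs_of_nonpos (by omega), abs_of_nonpos (by omega)]
        ring
    linarith

theorem exists_isFlipSequence {μ ν : P.MV} {f g : P.Face → ℤ} (hf : IsPotential μ f)
    (hg : IsPotential ν g) (heven : ∀ u, Even (f u - g u)) :
    ∃ l, IsFlipSequence ν μ l ∧ 2 * (l.length : ℤ) = ∑ v, |f v - g v| := by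
  obtain ⟨n, hn⟩ : ∃ n : ℕ, ∑ v, |f v - g v| ≤ n :=
    ⟨(∑ v, |f v - g v|).toNat, Int.self_le_toNat _⟩
  induction n generalizing μ f with
  | zero =>
    have h0 : ∑ v, |f v - g v| = 0 :=
      le_antisymm (by exact_mod_cast hn) (Finset.sum_nonneg fun _ _ => abs_nonneg _)
    have h1 : f = g := by
      funext v
      have := (Finset.sum_eq_zero_iff_of_nonneg fun _ _ => abs_nonneg _).1 h0 v (Finset.mem_univ v)
      rwa [abs_eq_zero, sub_eq_zero] at this
    subst h1
    exact ⟨[], ⟨hf.locallyValid, hf.unique hg⟩, by simp⟩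
  | succ n ih =>
    have step : ∀ ε : ℤ, (ε = 1 ∨ ε = -1) → (∃ v, 0 < ε * (f v - g v)) →
        ∃ l, IsFlipSequence ν μ l ∧ 2 * (l.length : ℤ) = ∑ v, |f v - g v| := by
      rintro ε hε ⟨v, hv⟩
      obtain ⟨F, hF, hmax⟩ := Finset.exists_max_image
        (Finset.univ.filter fun v => 0 < ε * (f v - g v)) (fun v => ε * f v) ⟨v, by simpa using hv⟩
      simp only [Finset.mem_filter, Finset.mem_univ, true_and] at hF hmax
      obtain ⟨h1, h2, h3⟩ := hf.flip_toward hg hε heven hF hmax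
      obtain ⟨l, hl, hlen⟩ := ih h1 h2 (by push_cast at hn; linarith)
      refine ⟨F :: l, ⟨hf.locallyValid, hl⟩, ?_⟩
      rw [List.length_cons]
      push_cast
      linarith
    by_cases h1 : ∃ v, 0 < 1 * (f v - g v)
    · exact step 1 (Or.inl rfl) h1
    by_cases h2 : ∃ v, 0 < -1 * (f v - g v)
    · exact step (-1) (Or.inr rfl) h2
    push Not at h1 h2
    have h3 : f = g := by
      funext v
      linarith [h1 v, h2 v]
    subst h3
    exact ⟨[], ⟨hf.locallyValid, hf.unique hg⟩, by simp⟩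

/-! ### The minimum length of a flip sequence -/

theorem abs_sub_le_of_adj {n : ℕ} (h : Fin (n + 1) → ℤ) {c : ℤ}
    (hh : ∀ i : Fin n, |h i.castSucc - h i.succ| ≤ c) (i i' : Fin (n + 1)) :
    |h i - h i'| ≤ c * n := by
  have hc : 0 ≤ c * n := by
    rcases Nat.eq_zero_or_pos n with rfl | hn
    · simp
    · exact mul_nonneg ((abs_nonneg _).trans (hh ⟨0, hn⟩)) (by positivity)
  have main : ∀ d : ℕ, ∀ i i' : Fin (n + 1), (i' : ℕ) = i + d → |h i - h i'| ≤ c * d := by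
    intro d
    induction d with
    | zero =>
      intro i i' hi
      rw [Fin.ext (show (i' : ℕ) = i from hi)]
      simp
    | succ d ih =>
      intro i i' hi
      have h1 := ih i (⟨i + d, by omega⟩) rfl
      have h2 := hh ⟨i + d, by omega⟩
      have h3 : i' = Fin.succ ⟨i + d, by omega⟩ := Fin.ext hi
      rw [h3]
      refine (abs_sub_le _ _ _).trans ((add_le_add h1 h2).trans_eq ?_)
      push_cast
      ring
  have main' : ∀ i i' : Fin (n + 1), i ≤ i' → |h i - h i'| ≤ c * n := by
    intro i i' hi
    refine (main (i' - i) i i' (by have : (i : ℕ) ≤ i' := hi; omega)).trans ?_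
    rcases Nat.eq_zero_or_pos n with rfl | hn
    · have h1 : (i' : ℕ) - i = 0 := by omega
      rw [h1]
    · refine mul_le_mul_of_nonneg_left ?_ ((abs_nonneg _).trans (hh ⟨0, hn⟩))
      have : (i' : ℕ) - i ≤ n := by omega
      exact_mod_cast this
  rcases le_total i i' with hi | hi
  · exact main' i i' hi
  · rw [abs_sub_comm]
    exact main' i' i hi

/-- `f - g` changes by at most two across a crease, and a row followed by a column joins any two
faces. -/
theorem IsPotential.abs_sub_sub_le {μ ν : P.MV} {f g : P.Face → ℤ} (hf : IsPotential μ f)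
    (hg : IsPotential ν g) (u v : P.Face) :
    |(f u - g u) - (f v - g v)| ≤ 2 * (P.zigzags + P.lines : ℤ) := by
  have key : ∀ u v, P.grid.Adj u v → |(f u - g u) - (f v - g v)| ≤ 2 := by
    intro u v huv
    have h1 := hf.abs_sub _ _ huv
    have h2 := hg.abs_sub _ _ huv
    rcases (abs_eq (by norm_num)).1 h1 with h1 | h1 <;>
      rcases (abs_eq (by norm_num)).1 h2 with h2 | h2 <;> rw [abs_le] <;> constructor <;> omega
  obtain ⟨i, j⟩ := u
  obtain ⟨i', j'⟩ := v
  have h1 := abs_sub_le_of_adj (fun i => f (i, j) - g (i, j)) (fun i => key _ _ (adj_zig i j)) i i'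
  have h2 := abs_sub_le_of_adj (fun j => f (i', j) - g (i', j))
    (fun j => key _ _ (adj_line i' j)) j j'
  refine (abs_sub_le _ (f (i', j) - g (i', j)) _).trans ((add_le_add h1 h2).trans_eq ?_)
  ring

theorem two_mul_length_le_totalDiff {μ ν : P.MV} {l : List P.Face} (hl : IsMinFlipSequence μ ν l)
    {f g : P.Face → ℤ} (hf : IsPotential μ f) (hg : IsPotential ν g) {t : ℤ}
    (ht : Possible f g t) : 2 * (l.length : ℤ) ≤ totalDiff f g t := by
  obtain ⟨l', h1, h2⟩ := exists_isFlipSequence hf (hg.add_const t) ht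
  have := hl.2 l' h1
  unfold totalDiff
  omega

theorem exists_possible_totalDiff {μ ν : P.MV} {l : List P.Face} (hl : IsMinFlipSequence μ ν l)
    {f g : P.Face → ℤ} (hf : IsPotential μ f) (hg : IsPotential ν g) (v₀ : P.Face) :
    ∃ t : ℤ, Possible f g t ∧ |t - (f v₀ - g v₀)| ≤ 2 * (P.zigzags + P.lines : ℤ) ∧
      2 * (l.length : ℤ) = totalDiff f g t := by
  obtain ⟨f', hf', heven, hsum⟩ := hl.1.exists_lift hf
  obtain ⟨t, ht⟩ : ∃ t, t = f' v₀ - g v₀ := ⟨_, rfl⟩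
  have hf't : ∀ v, f' v = g v + t := by
    intro v
    linarith [hf'.eq_add_const hg v v₀]
  simp only [hf't] at heven hsum
  have heq : 2 * (l.length : ℤ) = totalDiff f g t :=
    le_antisymm (two_mul_length_le_totalDiff hl hf hg heven) hsum
  have hcard : (Finset.univ : Finset P.Face).Nonempty := ⟨v₀, Finset.mem_univ _⟩
  -- If `t` exceeded every value of `f - g`, parity would make each gap at least two, and `t - 2`
  -- would lower every term. `hdown` is symmetric; together they place `t` within the range of `f -
  -- g`.
  have hup : ∃ v, t ≤ f v - g v := by
    by_contra! hcon
    have h1 : Possible f g (t - 2) := fun v => by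
      have := heven v
      rw [Int.even_iff] at this ⊢
      omega
    have h2 := two_mul_length_le_totalDiff hl hf hg h1
    have h3 : totalDiff f g (t - 2) < totalDiff f g t := by
      refine Finset.sum_lt_sum_of_nonempty hcard fun v _ => ?_
      have := hcon v
      obtain ⟨r, hr⟩ := heven v
      rw [abs_of_nonpos (by omega), abs_of_nonpos (by omega)]
      omega
    omega
  have hdown : ∃ v, f v - g v ≤ t := by
    by_contra! hcon
    have h1 : Possible f g (t + 2) := fun v => by
      have := heven v
      rw [Int.even_iff] at this ⊢
      omega
    have h2 := two_mul_length_le_totalDiff hl hf hg h1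
    have h3 : totalDiff f g (t + 2) < totalDiff f g t := by
      refine Finset.sum_lt_sum_of_nonempty hcard fun v _ => ?_
      have := hcon v
      obtain ⟨r, hr⟩ := heven v
      rw [abs_of_nonneg (by omega), abs_of_nonneg (by omega)]
      omega
    omega
  refine ⟨t, heven, ?_, heq⟩
  obtain ⟨v, hv⟩ := hup
  obtain ⟨w, hw⟩ := hdown
  have h1 := abs_le.1 (hf.abs_sub_sub_le hg v v₀)
  have h2 := abs_le.1 (hf.abs_sub_sub_le hg w v₀)
  rw [abs_le]
  constructor <;> linarith

/-- Testing the window is enough: a shortest sequence exists by well-ordering of the lengths, and it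
realizes its length at some translation in the window. -/
theorem isMinFlipSequence_of_totalDiff {μ ν : P.MV} {l : List P.Face}
    (hl : IsFlipSequence ν μ l) {f g : P.Face → ℤ} (hf : IsPotential μ f)
    (hg : IsPotential ν g) (v₀ : P.Face)
    (h : ∀ t, Possible f g t → |t - (f v₀ - g v₀)| ≤ 2 * (P.zigzags + P.lines : ℤ) →
      2 * (l.length : ℤ) ≤ totalDiff f g t) : IsMinFlipSequence μ ν l := by
  refine ⟨hl, fun l' hl' => ?_⟩
  obtain ⟨m, hm, hmin⟩ := exists_minimal_of_wellFoundedLT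
    (fun n => ∃ l : List P.Face, IsFlipSequence ν μ l ∧ l.length = n) ⟨_, l', hl', rfl⟩
  obtain ⟨l₀, hl₀, rfl⟩ := hm
  have hmin' : IsMinFlipSequence μ ν l₀ :=
    ⟨hl₀, fun l'' h'' => (le_total _ _).elim id fun h => hmin ⟨l'', h'', rfl⟩ h⟩
  obtain ⟨t, h1, h2, h3⟩ := exists_possible_totalDiff hmin' hf hg v₀
  have := h t h1 h2
  have := hmin'.2 l' hl'
  omega

end MiuraFlip.Miura

namespace RAM

/-! ### Verification of programs -/

/-- Upper bound for the number of steps of a program without loops. -/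
def cost : Prog → ℕ
  | .seq p q => cost p + cost q
  | .cond _ p q => cost p + cost q + 1
  | _ => 1

/-- The program contains no loop. -/
def loopFree : Prog → Bool
  | .seq p q => loopFree p && loopFree q
  | .cond _ p q => loopFree p && loopFree q
  | .loop _ _ => false
  | _ => true

/-- The final state of a program without loops. -/
def eval : Prog → State → State
  | .const x k, s => { s with reg := Function.update s.reg x k }
  | .add x y z, s => { s with reg := Function.update s.reg x (s.reg y + s.reg z) }
  | .sub x y z, s => { s with reg := Function.update s.reg x (s.reg y - s.reg z) }
  | .load x y, s => { s with reg := Function.update s.reg x (s.mem (s.reg y)) }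
  | .store x y, s => { s with mem := Function.update s.mem (s.reg x) (s.reg y) }
  | .emit x, s => { s with out := s.out ++ [s.reg x] }
  | .seq p q, s => eval q (eval p s)
  | .cond x p q, s => if s.reg x = 0 then eval q s else eval p s
  | .loop _ _, s => s

/-- This lets straight-line code be executed by simplifying `eval` rather than by building
derivations of `Runs`. -/
theorem exists_runs_eval (p : Prog) (hp : loopFree p = true) (s : State) :
    ∃ t, Runs p s t (eval p s) ∧ t ≤ cost p := by
  induction p generalizing s with
  | const x k => exact ⟨1, .const .., le_rfl⟩
  | add x y z => exact ⟨1, .add .., le_rfl⟩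
  | sub x y z => exact ⟨1, .sub .., le_rfl⟩
  | load x y => exact ⟨1, .load .., le_rfl⟩
  | store x y => exact ⟨1, .store .., le_rfl⟩
  | emit x => exact ⟨1, .emit .., le_rfl⟩
  | seq p q ihp ihq =>
    rw [loopFree, Bool.and_eq_true] at hp
    obtain ⟨t, h, ht⟩ := ihp hp.1 s
    obtain ⟨t', h', ht'⟩ := ihq hp.2 (eval p s)
    exact ⟨_, .seq h h', add_le_add ht ht'⟩
  | cond x p q ihp ihq =>
    rw [loopFree, Bool.and_eq_true] at hp
    by_cases hx : s.reg x = 0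
    · obtain ⟨t, h, ht⟩ := ihq hp.2 s
      exact ⟨t + 1, by simpa [eval, hx] using .cond_false hx h, by simp only [cost]; omega⟩
    · obtain ⟨t, h, ht⟩ := ihp hp.1 s
      exact ⟨t + 1, by simpa [eval, hx] using .cond_true hx h, by simp only [cost]; omega⟩
  | loop x p => cases hp

/-- The program may change the register `r`. -/
def writes : Prog → ℕ → Bool
  | .const x _, r => x == r
  | .add x _ _, r => x == r
  | .sub x _ _, r => x == r
  | .load x _, r => x == r
  | .store _ _, _ => false
  | .emit _, _ => false
  | .seq p q, r => writes p r || writes q r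
  | .cond _ p q, r => writes p r || writes q r
  | .loop _ p, r => writes p r

/-- The program may change the memory. -/
def stores : Prog → Bool
  | .store _ _ => true
  | .seq p q => stores p || stores q
  | .cond _ p q => stores p || stores q
  | .loop _ p => stores p
  | _ => false

/-- The program may write on the output tape. -/
def emits : Prog → Bool
  | .emit _ => true
  | .seq p q => emits p || emits q
  | .cond _ p q => emits p || emits q
  | .loop _ p => emits p
  | _ => false

/-- The states `s` and `s'` agree in what `p` cannot change. -/
structure Frame (p : Prog) (s s' : State) : Prop where
  reg : ∀ r, writes p r = false → s'.reg r = s.reg r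
  mem : stores p = false → s'.mem = s.mem
  out : emits p = false → s'.out = s.out

theorem Frame.rfl {p : Prog} {s : State} : Frame p s s :=
  ⟨fun _ _ => Eq.refl _, fun _ => Eq.refl _, fun _ => Eq.refl _⟩

theorem Frame.trans {p : Prog} {s s' s'' : State} (h : Frame p s s') (h' : Frame p s' s'') :
    Frame p s s'' :=
  ⟨fun r hr => (h'.reg r hr).trans (h.reg r hr), fun hr => (h'.mem hr).trans (h.mem hr),
    fun hr => (h'.out hr).trans (h.out hr)⟩

theorem Frame.mono {p q : Prog} {s s' : State} (h : Frame p s s')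
    (h1 : ∀ r, writes q r = false → writes p r = false) (h2 : stores q = false → stores p = false)
    (h3 : emits q = false → emits p = false) : Frame q s s' :=
  ⟨fun r hr => h.reg r (h1 r hr), fun hr => h.mem (h2 hr), fun hr => h.out (h3 hr)⟩

theorem Runs.frame {p : Prog} {s s' : State} {t : ℕ} (h : Runs p s t s') : Frame p s s' := by
  induction h with
  | const | add | sub | load =>
    refine ⟨fun r hr => ?_, fun _ => Eq.refl _, fun _ => Eq.refl _⟩
    simp only [writes, beq_eq_false_iff_ne] at hr
    exact Function.update_of_ne hr.symm ..
  | store => exact ⟨fun _ _ => Eq.refl _, fun h => by simp [stores] at h, fun _ => Eq.refl _⟩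
  | emit => exact ⟨fun _ _ => Eq.refl _, fun _ => Eq.refl _, fun h => by simp [emits] at h⟩
  | seq _ _ ih ih' =>
    refine (ih.mono ?_ ?_ ?_).trans (ih'.mono ?_ ?_ ?_) <;>
      simp +contextual [writes, stores, emits]
  | cond_true _ _ ih | cond_false _ _ ih =>
    refine ih.mono ?_ ?_ ?_ <;> simp +contextual [writes, stores, emits]
  | loop_done => exact .rfl
  | loop_step _ _ _ ih ih' => exact Frame.trans (ih.mono (fun _ => id) id id) ih'

/-- Started in `s`, the program halts after at most `T` steps in a state satisfying `Q`. -/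
def Exec (p : Prog) (s : State) (T : ℕ) (Q : State → Prop) : Prop :=
  ∃ t s', Runs p s t s' ∧ t ≤ T ∧ Q s'

theorem Exec.mono {p : Prog} {s : State} {T T' : ℕ} {Q Q' : State → Prop} (h : Exec p s T Q)
    (hT : T ≤ T') (hQ : ∀ s', Frame p s s' → Q s' → Q' s') : Exec p s T' Q' := by
  obtain ⟨t, s', hr, ht, hq⟩ := h
  exact ⟨t, s', hr, ht.trans hT, hQ s' hr.frame hq⟩

theorem Exec.of_eval {p : Prog} {s : State} {Q : State → Prop} (hp : loopFree p = true)
    (hQ : Q (eval p s)) : Exec p s (cost p) Q := by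
  obtain ⟨t, h, ht⟩ := exists_runs_eval p hp s
  exact ⟨t, _, h, ht, hQ⟩

theorem Exec.seq {p q : Prog} {s : State} {T T' : ℕ} {Q Q' : State → Prop} (h : Exec p s T Q)
    (h' : ∀ s', Frame p s s' → Q s' → Exec q s' T' Q') : Exec (.seq p q) s (T + T') Q' := by
  obtain ⟨t, s', hr, ht, hq⟩ := h
  obtain ⟨t', s'', hr', ht', hq'⟩ := h' s' hr.frame hq
  exact ⟨_, s'', .seq hr hr', add_le_add ht ht', hq'⟩

/-- The counter register is the termination measure and indexes the invariant. The frame relative to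
`s₀` is available in each round, so invariants need not mention what the body leaves alone. -/
theorem Exec.loop {c : ℕ} {p : Prog} {T : ℕ} (I : ℕ → State → Prop) {s₀ : State}
    (hc : ∀ n s, I n s → s.reg c = n)
    (hstep : ∀ n s, Frame p s₀ s → I (n + 1) s → Exec p s T (I n)) {n : ℕ} (h : I n s₀) :
    Exec (.loop c p) s₀ (n * (T + 1) + 1) (I 0) := by
  have key : ∀ n s, Frame p s₀ s → I n s → Exec (.loop c p) s (n * (T + 1) + 1) (I 0) := by
    intro n
    induction n with
    | zero => exact fun s _ hs => ⟨1, s, .loop_done (hc 0 s hs), by omega, hs⟩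
    | succ n ih =>
      intro s hf hs
      obtain ⟨t, s', hr, ht, hq⟩ := hstep n s hf hs
      obtain ⟨t', s'', hr', ht', hq'⟩ := ih s' (hf.trans hr.frame) hq
      refine ⟨_, s'', .loop_step (by rw [hc _ s hs]; omega) hr hr', ?_, hq'⟩
      rw [Nat.succ_mul]
      omega
  exact key n s₀ .rfl h

/-! ### The program -/

namespace MinFlip

local infixr:30 " ;; " => Prog.seq

/-- Compute products of the sizes by repeated addition. -/
def countLoop : Prog := .loop 8 (.add 6 6 1 ;; .add 7 7 4 ;; .sub 8 8 30)

/-- Load the constants and the sizes. -/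
def readSizes : Prog :=
  .const 30 1 ;; .const 31 3 ;; .const 22 2 ;; .load 1 0 ;; .load 2 30 ;; .load 3 22 ;;
  .add 4 1 30 ;; .add 5 2 30 ;; .add 8 5 0

/-- Compute the number of creases and the addresses of the two tables of faces. -/
def layout : Prog :=
  .sub 9 7 4 ;; .add 9 9 6 ;; .add 10 4 5 ;;
  .add 11 9 9 ;; .add 11 11 31 ;; .add 11 11 30 ;;
  .add 12 7 7 ;; .add 12 12 7 ;; .add 12 12 11

/-- Write the record of a face, with its two coordinates and its height, and go to the next. -/
def heightBody : Prog :=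
  .store 16 19 ;; .add 16 16 30 ;; .store 16 20 ;; .add 16 16 30 ;; .store 16 21 ;;
  .add 16 16 30 ;; .sub 22 1 19 ;;
  .cond 22
    (.load 23 13 ;; .add 13 13 30 ;; .sub 24 23 17 ;; .sub 25 17 23 ;; .add 24 24 25 ;;
      .add 21 21 30 ;; .sub 21 21 24 ;; .sub 21 21 24 ;; .add 19 19 30)
    (.add 19 0 0 ;; .add 20 20 30 ;; .load 23 14 ;; .add 14 14 4 ;; .sub 24 30 23 ;;
      .add 15 15 30 ;; .sub 15 15 24 ;; .sub 15 15 24 ;; .add 21 15 0 ;; .sub 17 30 17) ;;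
  .sub 18 18 30

/-- Register 17 is the direction bit of the row, 18 counts the remaining faces, 19 and 20 are the
coordinates, and 21 is the current height. -/
def resetHeights : Prog :=
  .add 17 3 0 ;; .add 18 7 0 ;; .add 19 0 0 ;; .add 20 0 0 ;; .add 21 15 0

/-- Registers 13 and 14 point to the zigzag and line bits, 16 to the table to be written. With `S`
in register 10, the base height in 15 is `4 * S` here and `2 * S` in `prepareSecond`: this makes all
relevant translations nonnegative and keeps heights away from truncation. -/
def prepareFirst : Prog :=
  .add 13 31 0 ;; .add 14 31 6 ;; .add 22 10 10 ;; .add 15 22 22 ;; .add 16 11 0 ;; resetHeights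

def prepareSecond : Prog :=
  .add 13 31 9 ;; .add 14 13 6 ;; .add 15 10 10 ;; .add 16 12 0 ;; resetHeights

/-- The sum of the differences of the heights, with the second ones translated. -/
def sumBody : Prog :=
  .load 22 27 ;; .load 23 28 ;; .add 23 23 25 ;; .sub 24 22 23 ;; .add 26 26 24 ;;
  .sub 24 23 22 ;; .add 26 26 24 ;; .add 27 27 31 ;; .add 28 28 31 ;; .sub 29 29 30

def sumPass : Prog :=
  (.add 26 0 0 ;; .add 27 11 0 ;; .add 28 12 0 ;; .add 29 7 0) ;; .loop 29 sumBody

/-- Search for the best translation. -/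
def searchBody : Prog :=
  (.add 25 25 30 ;; .add 25 25 30) ;; sumPass ;;
  (.sub 22 32 26 ;; .cond 22 (.add 32 26 0 ;; .add 33 25 0) (.const 22 0) ;; .sub 34 34 30)

def search : Prog :=
  .add 25 0 0 ;; sumPass ;; (.add 32 26 0 ;; .add 33 0 0 ;; .add 34 10 10) ;;
  .loop 34 searchBody ;; .add 25 33 0

/-- Register 27 points to the height in a record; the coordinates are in the two preceding cells. -/
def emitFace : Prog :=
  .sub 39 27 30 ;; .load 40 39 ;; .sub 41 39 30 ;; .load 41 41 ;; .emit 41 ;; .emit 40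

/-- Flip a face if it is on the current level of height. -/
def flipBody : Prog :=
  .load 22 27 ;; .load 23 28 ;; .add 23 23 25 ;; .sub 26 22 23 ;;
  .cond 26
    (.sub 24 37 22 ;; .cond 24 (.const 24 0)
      (emitFace ;; .sub 22 22 30 ;; .sub 22 22 30 ;; .store 27 22))
    (.sub 26 23 22 ;; .cond 26
      (.sub 24 22 38 ;; .cond 24 (.const 24 0)
        (emitFace ;; .add 22 22 30 ;; .add 22 22 30 ;; .store 27 22))
      (.const 24 0)) ;;
  .add 27 27 31 ;; .add 28 28 31 ;; .sub 29 29 30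

/-- Register 36 is the level plus one, so that level `0` is still processed; 37 is the level and 38
its mirror image for the upward flips. -/
def levelBody : Prog :=
  (.sub 37 36 30 ;; .sub 38 35 37 ;; .add 27 11 0 ;; .add 28 12 0 ;; .add 29 7 0) ;;
  .loop 29 flipBody ;; .sub 36 36 30

/-- The top level `8 * S` bounds all heights and all translated target heights. -/
def sweep : Prog :=
  (.add 35 10 10 ;; .add 35 35 35 ;; .add 35 35 35 ;; .add 36 35 30) ;; .loop 36 levelBody

/-- The whole program. -/
def program : Prog :=
  readSizes ;; countLoop ;; layout ;;
  prepareFirst ;; .loop 18 heightBody ;; prepareSecond ;; .loop 18 heightBody ;;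
  (.add 22 30 30 ;; .add 11 11 22 ;; .add 12 12 22) ;; search ;; sweep

/-! ### Specifications of the parts -/

theorem countLoop_spec (s : State) (h6 : s.reg 6 = 0) (h7 : s.reg 7 = 0) (h30 : s.reg 30 = 1) :
    Exec countLoop s (s.reg 8 * 4 + 1)
      (fun s' => s'.reg 6 = s.reg 8 * s.reg 1 ∧ s'.reg 7 = s.reg 8 * s.reg 4) := by
  refine (Exec.loop (T := 3) (fun n s' => s'.reg 8 = n ∧
    s'.reg 6 + n * s.reg 1 = s.reg 8 * s.reg 1 ∧
    s'.reg 7 + n * s.reg 4 = s.reg 8 * s.reg 4) (fun n s' h => h.1) ?_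
    (n := s.reg 8) ⟨rfl, by simp [h6], by simp [h7]⟩).mono le_rfl ?_
  · intro n s' hf ⟨h1, h2, h3⟩
    refine Exec.of_eval rfl ?_
    have e1 := hf.reg 1 rfl
    have e4 := hf.reg 4 rfl
    have e30 := hf.reg 30 rfl
    rw [h30] at e30
    simp only [eval, Function.update_apply]
    simp [e1, e4, e30, h1]
    rw [Nat.succ_mul] at h2 h3
    omega
  · intro s' _ h
    simpa using h.2

/-- The direction bit of a row. -/
def rowBit (d : ℕ) : ℕ → ℕ
  | 0 => d
  | j + 1 => 1 - rowBit d j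

/-- The heights in the first column. -/
def colHeight (m : ℕ → ℕ) (k lp h : ℕ) : ℕ → ℕ
  | 0 => h
  | j + 1 => colHeight m k lp h j + 1 - (1 - m (lp + j * (k + 1))) - (1 - m (lp + j * (k + 1)))

/-- The heights that the program computes. -/
def tableHeight (m : ℕ → ℕ) (k zp lp d h : ℕ) : ℕ → ℕ → ℕ
  | 0, j => colHeight m k lp h j
  | i + 1, j => tableHeight m k zp lp d h i j + 1 -
      ((m (zp + j * k + i) - rowBit d j) + (rowBit d j - m (zp + j * k + i))) -
      ((m (zp + j * k + i) - rowBit d j) + (rowBit d j - m (zp + j * k + i)))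

theorem mod_div_succ_of_lt {k a : ℕ} (h : a % (k + 1) < k) :
    (a + 1) % (k + 1) = a % (k + 1) + 1 ∧ (a + 1) / (k + 1) = a / (k + 1) := by
  have h1 := Nat.mod_add_div a (k + 1)
  have h2 : a + 1 = (a % (k + 1) + 1) + (k + 1) * (a / (k + 1)) := by omega
  constructor
  · conv_lhs => rw [h2]
    rw [Nat.add_mul_mod_self_left, Nat.mod_eq_of_lt (by omega)]
  · conv_lhs => rw [h2]
    rw [Nat.add_mul_div_left _ _ (by omega), Nat.div_eq_of_lt (by omega), zero_add]

theorem mod_div_succ_of_not_lt {k a : ℕ} (h : ¬ a % (k + 1) < k) :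
    (a + 1) % (k + 1) = 0 ∧ (a + 1) / (k + 1) = a / (k + 1) + 1 := by
  have h1 := Nat.mod_add_div a (k + 1)
  have h3 := Nat.mod_lt a (show 0 < k + 1 by omega)
  have h2 : a + 1 = (k + 1) * (a / (k + 1) + 1) := by rw [mul_add]; omega
  constructor
  · rw [h2, Nat.mul_mod_right]
  · conv_lhs => rw [h2]
    rw [Nat.mul_div_cancel_left _ (by omega)]

/-- All bits that are read lie below `op` (`hz`, `hl`) and all writes are at `op` or above, so the
loop always sees the original input. -/
theorem heightLoop_spec (s : State) (k N zp lp h d op : ℕ) (h0 : s.reg 0 = 0) (h1 : s.reg 1 = k)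
    (h4 : s.reg 4 = k + 1) (h30 : s.reg 30 = 1) (h13 : s.reg 13 = zp) (h14 : s.reg 14 = lp)
    (h15 : s.reg 15 = h) (h16 : s.reg 16 = op) (h17 : s.reg 17 = d) (h18 : s.reg 18 = N)
    (h19 : s.reg 19 = 0) (h20 : s.reg 20 = 0) (h21 : s.reg 21 = h)
    (hz : ∀ a < N, a % (k + 1) < k → zp + a / (k + 1) * k + a % (k + 1) < op)
    (hl : ∀ a < N, lp + a / (k + 1) * (k + 1) < op) :
    Exec (.loop 18 heightBody) s (N * 29 + 1) (fun s' =>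
      (∀ x < op, s'.mem x = s.mem x) ∧ ∀ a < N, s'.mem (op + 3 * a) = a % (k + 1) ∧
        s'.mem (op + 3 * a + 1) = a / (k + 1) ∧
        s'.mem (op + 3 * a + 2) = tableHeight s.mem k zp lp d h (a % (k + 1)) (a / (k + 1))) := by
  refine (Exec.loop (T := 28) (fun n s' => s'.reg 18 = n ∧ ∃ a, a + n = N ∧
    s'.reg 16 = op + 3 * a ∧ s'.reg 19 = a % (k + 1) ∧ s'.reg 20 = a / (k + 1) ∧
    s'.reg 13 = zp + a / (k + 1) * k + a % (k + 1) ∧ s'.reg 14 = lp + a / (k + 1) * (k + 1) ∧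
    s'.reg 15 = colHeight s.mem k lp h (a / (k + 1)) ∧
    s'.reg 21 = tableHeight s.mem k zp lp d h (a % (k + 1)) (a / (k + 1)) ∧
    s'.reg 17 = rowBit d (a / (k + 1)) ∧
    (∀ x < op, s'.mem x = s.mem x) ∧ ∀ a' < a, s'.mem (op + 3 * a') = a' % (k + 1) ∧
        s'.mem (op + 3 * a' + 1) = a' / (k + 1) ∧
        s'.mem (op + 3 * a' + 2) = tableHeight s.mem k zp lp d h (a' % (k + 1)) (a' / (k + 1)))
    (fun n s' h => h.1) ?_ (n := N) ?_).mono le_rfl ?_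
  · rintro n s' hf ⟨e18, a, ha, e16, e19, e20, e13, e14, e15, e21, e17, hmem, hrec⟩
    refine Exec.of_eval rfl ?_
    have e0 := (hf.reg 0 rfl).trans h0
    have e1 := (hf.reg 1 rfl).trans h1
    have e4 := (hf.reg 4 rfl).trans h4
    have e30 := (hf.reg 30 rfl).trans h30
    have hz' := hz a (by omega)
    have hl' := hl a (by omega)
    have hmem' : ∀ x < op, Function.update (Function.update (Function.update s'.mem
        (op + 3 * a) (a % (k + 1))) (op + 3 * a + 1) (a / (k + 1))) (op + 3 * a + 1 + 1)
        (tableHeight s.mem k zp lp d h (a % (k + 1)) (a / (k + 1))) x = s.mem x := by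
      intro x hx
      rw [Function.update_of_ne (by omega), Function.update_of_ne (by omega),
        Function.update_of_ne (by omega), hmem x hx]
    have hrec' : ∀ a' < a + 1, ∀ M : ℕ → ℕ, M = Function.update (Function.update
        (Function.update s'.mem (op + 3 * a) (a % (k + 1))) (op + 3 * a + 1) (a / (k + 1))) (op + 3 * a + 1 + 1)
        (tableHeight s.mem k zp lp d h (a % (k + 1)) (a / (k + 1))) →
        M (op + 3 * a') = a' % (k + 1) ∧ M (op + 3 * a' + 1) = a' / (k + 1) ∧
        M (op + 3 * a' + 2) = tableHeight s.mem k zp lp d h (a' % (k + 1)) (a' / (k + 1)) := by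
      rintro a' ha' M rfl
      by_cases haa : a' = a
      · subst haa
        refine ⟨?_, ?_, Function.update_self ..⟩
        · rw [Function.update_of_ne (by omega), Function.update_of_ne (by omega),
            Function.update_self]
        · rw [Function.update_of_ne (by omega), Function.update_self]
      · obtain ⟨r1, r2, r3⟩ := hrec a' (by omega)
        refine ⟨?_, ?_, ?_⟩ <;> rw [Function.update_of_ne (by omega),
          Function.update_of_ne (by omega), Function.update_of_ne (by omega)] <;> assumption
    -- Inside a row the height continues from the left neighbour. At the end of a row the scan
    -- returns to the first column, whose height is kept in register 15, and the direction bit is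
    -- reversed.
    by_cases hlt : a % (k + 1) < k
    · obtain ⟨d1, d2⟩ := mod_div_succ_of_lt hlt
      have hne : ¬ k - a % (k + 1) = 0 := by omega
      have hread := hmem' _ (hz' hlt)
      simp only [heightBody, eval, Function.update_self, Function.update_of_ne, ne_eq,
        Nat.reduceEqDiff, not_false_eq_true, e1, e16, e19, hne, if_false,
        e30, e13, e14, e15, e17, e18, e20, e21, hread]
      refine ⟨by omega, a + 1, by omega, by omega, ?_⟩
      rw [d1, d2]
      refine ⟨rfl, rfl, by omega, rfl, rfl, ?_, rfl, hmem', fun a' ha' => hrec' a' ha' _ rfl⟩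
      rw [tableHeight]
    · obtain ⟨d1, d2⟩ := mod_div_succ_of_not_lt hlt
      have heq : k - a % (k + 1) = 0 := by omega
      have hread := hmem' _ hl'
      simp only [heightBody, eval, Function.update_self, Function.update_of_ne, ne_eq,
        Nat.reduceEqDiff, not_false_eq_true, e0, e1, e4, e16, e19, heq, if_true,
        e30, e13, e14, e15, e17, e18, e20, e21, hread]
      refine ⟨by omega, a + 1, by omega, by omega, ?_⟩
      rw [d1, d2]
      refine ⟨rfl, rfl, ?_, by rw [Nat.succ_mul]; omega, ?_, ?_, rfl, hmem',
        fun a' ha' => hrec' a' ha' _ rfl⟩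
      · have := Nat.mod_lt a (show 0 < k + 1 by omega)
        rw [Nat.succ_mul]
        omega
      · rw [colHeight]
      · rw [tableHeight, colHeight]
        rfl
  · refine ⟨h18, 0, by omega, ?_⟩
    simp [h16, h19, h20, h13, h14, h15, h21, h17, tableHeight, colHeight, rowBit]
  · rintro s' - ⟨-, a, ha, -, -, -, -, -, -, -, -, hmem, hrec⟩
    obtain rfl : a = N := by omega
    exact ⟨hmem, hrec⟩

/-- The sum computed by the program for the heights at `p` and `q` and the translation `t`. -/
def heightSum (m : ℕ → ℕ) (N p q t : ℕ) : ℕ :=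
  ∑ a ∈ Finset.range N, ((m (p + 3 * a) - (m (q + 3 * a) + t)) + (m (q + 3 * a) + t - m (p + 3 * a)))

/-- Of the two truncated differences at a face one vanishes, so adding both gives the absolute
value. -/
theorem sumPass_spec (s : State) (h0 : s.reg 0 = 0) (h30 : s.reg 30 = 1) (h31 : s.reg 31 = 3) :
    Exec sumPass s (s.reg 7 * 11 + 5) (fun s' =>
      s'.reg 26 = heightSum s.mem (s.reg 7) (s.reg 11) (s.reg 12) (s.reg 25)) := by
  refine (Exec.seq (T := 4) (T' := s.reg 7 * 11 + 1) (Exec.of_eval (Q := fun s' => s'.reg 26 = 0 ∧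
    s'.reg 27 = s.reg 11 ∧ s'.reg 28 = s.reg 12 ∧ s'.reg 29 = s.reg 7) rfl ?_) ?_).mono
    (by omega) (fun s' _ h => h)
  · simp [eval, h0]
  · intro s₁ hf₁ ⟨h26, h27, h28, h29⟩
    have e7 := hf₁.reg 7 rfl
    have e11 := hf₁.reg 11 rfl
    have e12 := hf₁.reg 12 rfl
    have e25 := hf₁.reg 25 rfl
    have e30 := (hf₁.reg 30 rfl).trans h30
    have e31 := (hf₁.reg 31 rfl).trans h31
    have em := hf₁.mem rfl
    refine (Exec.loop (T := 10) (fun n s' => s'.reg 29 = n ∧ ∃ a, a + n = s.reg 7 ∧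
      s'.reg 27 = s.reg 11 + 3 * a ∧ s'.reg 28 = s.reg 12 + 3 * a ∧
      s'.reg 26 = heightSum s.mem a (s.reg 11) (s.reg 12) (s.reg 25))
      (fun n s' h => h.1) ?_ (n := s.reg 7) ?_).mono le_rfl ?_
    · rintro n s' hf ⟨f29, a, ha, f27, f28, f26⟩
      refine Exec.of_eval rfl ?_
      have f25 := (hf.reg 25 rfl).trans e25
      have f30 := (hf.reg 30 rfl).trans e30
      have f31 := (hf.reg 31 rfl).trans e31
      have fm := (hf.mem rfl).trans em
      simp only [sumBody, eval, Function.update_self, Function.update_of_ne, ne_eq,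
        Nat.reduceEqDiff, not_false_eq_true, f25, f26, f27, f28, f29, f30, f31, fm]
      refine ⟨by omega, a + 1, by omega, by omega, by omega, ?_⟩
      rw [heightSum, heightSum, Finset.sum_range_succ]
      omega
    · exact ⟨h29, 0, by omega, h27, h28, by simp [h26, heightSum]⟩
    · rintro s' - ⟨-, a, ha, -, -, h⟩
      obtain rfl : a = s.reg 7 := by omega
      exact h

/-- The registers that are not changed after the layout of the memory. -/
def constRegs : List ℕ := [0, 1, 3, 4, 6, 7, 9, 10, 11, 12, 30, 31]

def Consts (s s' : State) : Prop := ∀ r ∈ constRegs, s'.reg r = s.reg r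

theorem Consts.trans {s s' s'' : State} (h : Consts s s') (h' : Consts s' s'') : Consts s s'' :=
  fun r hr => (h' r hr).trans (h r hr)

theorem _root_.RAM.Frame.consts {p : Prog} {s s' : State} (h : Frame p s s')
    (hp : constRegs.all (fun r => !writes p r) = true) : Consts s s' := by
  intro r hr
  have := List.all_eq_true.1 hp r hr
  exact h.reg r (by simpa using this)

theorem search_spec (s : State) (h0 : s.reg 0 = 0) (h30 : s.reg 30 = 1) (h31 : s.reg 31 = 3) :
    Exec search s (s.reg 7 * 11 + 2 * s.reg 10 * (s.reg 7 * 11 + 14) + 11) (fun s' =>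
      ∃ u ≤ 2 * s.reg 10, s'.reg 25 = 2 * u ∧ ∀ u' ≤ 2 * s.reg 10,
        heightSum s.mem (s.reg 7) (s.reg 11) (s.reg 12) (2 * u) ≤
        heightSum s.mem (s.reg 7) (s.reg 11) (s.reg 12) (2 * u')) := by
  obtain ⟨σ, hσ⟩ : ∃ σ, σ = heightSum s.mem (s.reg 7) (s.reg 11) (s.reg 12) := ⟨_, rfl⟩
  rw [← hσ]
  have hsum : ∀ s', Consts s s' → s'.mem = s.mem → Exec sumPass s' (s.reg 7 * 11 + 5)
      (fun s'' => s''.reg 26 = σ (s'.reg 25)) := by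
    intro s' hc hm
    have h := sumPass_spec s' ((hc 0 (by decide)).trans h0) ((hc 30 (by decide)).trans h30)
      ((hc 31 (by decide)).trans h31)
    rwa [hc 7 (by decide), hc 11 (by decide), hc 12 (by decide), hm, ← hσ] at h
  refine (Exec.seq (Exec.of_eval (p := .add 25 0 0) (Q := fun s' => s'.reg 25 = 0) rfl
    (by simp [eval, h0])) fun s₁ hf₁ h₁ => Exec.seq (hsum s₁ (hf₁.consts rfl) (hf₁.mem rfl))
    fun s₂ hf₂ h₂ => Exec.seq (Exec.of_eval (Q := fun s' => s'.reg 32 = σ 0 ∧ s'.reg 33 = 0 ∧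
      s'.reg 34 = 2 * s.reg 10 ∧ s'.reg 25 = 0) rfl ?_) fun s₃ hf₃ h₃ =>
    -- After `v` rounds, registers 32 and 33 hold the best sum and its translation among `0, 2, …, 2
    -- * v`.
    Exec.seq (Exec.loop (T := s.reg 7 * 11 + 13) (fun n s' => s'.reg 34 = n ∧
      ∃ v, v + n = 2 * s.reg 10 ∧ s'.reg 25 = 2 * v ∧ ∃ u ≤ v, s'.reg 33 = 2 * u ∧
      s'.reg 32 = σ (2 * u) ∧ ∀ u' ≤ v, σ (2 * u) ≤ σ (2 * u')) (fun n s' h => h.1) ?_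
      (n := 2 * s.reg 10) ?_) fun s₄ hf₄ h₄ => Exec.of_eval rfl ?_).mono ?_ fun s' _ h => h
  · have e0 := (hf₂.reg 0 rfl).trans ((hf₁.reg 0 rfl).trans h0)
    have e10 := (hf₂.reg 10 rfl).trans (hf₁.reg 10 rfl)
    have e25 := (hf₂.reg 25 rfl).trans h₁
    rw [h₁] at h₂
    simp [eval, h₂, e0, e10, e25, two_mul]
  · rintro n s₄ hf₄ ⟨h34, v, hv, h25, u, hu, h33, h32, hmin⟩
    have hc₄ : Consts s s₄ := (((hf₁.consts rfl).trans (hf₂.consts rfl)).trans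
      (hf₃.consts rfl)).trans (hf₄.consts rfl)
    have hm₄ : s₄.mem = s.mem := (hf₄.mem rfl).trans ((hf₃.mem rfl).trans
      ((hf₂.mem rfl).trans (hf₁.mem rfl)))
    have e0 := (hc₄ 0 (by decide)).trans h0
    have e30 := (hc₄ 30 (by decide)).trans h30
    refine (Exec.seq (Exec.of_eval (Q := fun s' => s'.reg 25 = 2 * (v + 1)) rfl ?_)
      fun s₅ hf₅ h₅ => Exec.seq (hsum s₅ (hc₄.trans (hf₅.consts rfl)) ((hf₅.mem rfl).trans hm₄))
      fun s₆ hf₆ h₆ => Exec.of_eval rfl ?_).mono ?_ fun s' _ h => h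
    · simp [eval, h25, e30]
      omega
    · have g0 := (hf₆.reg 0 rfl).trans ((hf₅.reg 0 rfl).trans e0)
      have g30 := (hf₆.reg 30 rfl).trans ((hf₅.reg 30 rfl).trans e30)
      have g25 := (hf₆.reg 25 rfl).trans h₅
      have g32 := (hf₆.reg 32 rfl).trans ((hf₅.reg 32 rfl).trans h32)
      have g33 := (hf₆.reg 33 rfl).trans ((hf₅.reg 33 rfl).trans h33)
      have g34 := (hf₆.reg 34 rfl).trans ((hf₅.reg 34 rfl).trans h34)
      rw [h₅] at h₆
      by_cases hcmp : σ (2 * u) - σ (2 * (v + 1)) = 0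
      · simp only [eval, Function.update_self, Function.update_of_ne, ne_eq, Nat.reduceEqDiff,
          not_false_eq_true, g30, g25, g32, g33, g34, h₆, hcmp, if_true]
        refine ⟨by omega, v + 1, by omega, rfl, u, by omega, rfl, rfl, fun u' hu' => ?_⟩
        rcases Nat.of_le_succ hu' with h | rfl
        · exact hmin u' h
        · exact Nat.sub_eq_zero_iff_le.1 hcmp
      · simp only [eval, Function.update_self, Function.update_of_ne, ne_eq, Nat.reduceEqDiff,
          not_false_eq_true, g0, g30, g25, g34, g32, h₆, hcmp, if_false]
        refine ⟨by omega, v + 1, by omega, rfl, v + 1, le_rfl, rfl, rfl, fun u' hu' => ?_⟩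
        rcases Nat.of_le_succ hu' with h | rfl
        · exact le_trans (by omega) (hmin u' h)
        · exact le_rfl
    · simp only [cost]
      omega
  · exact ⟨h₃.2.2.1, 0, by omega, h₃.2.2.2, 0, le_rfl, h₃.2.1, h₃.1, fun u' hu' => by
      rw [Nat.le_zero.1 hu']⟩
  · obtain ⟨-, v, hv, h25, u, hu, h33, h32, hmin⟩ := h₄
    obtain rfl : v = 2 * s.reg 10 := by omega
    have e0 : s₄.reg 0 = 0 := ((hf₄.reg 0 rfl).trans ((hf₃.reg 0 rfl).trans
      ((hf₂.reg 0 rfl).trans (hf₁.reg 0 rfl)))).trans h0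
    exact ⟨u, hu, by simp [eval, h33, e0], hmin⟩
  · simp only [cost, Nat.add_assoc, Nat.reduceAdd]
    omega

/-- The course of the sweep: `Sweep N H f γ c a φ l` says that in the pass over the faces on
level `c - 1`, before the face number `a`, the heights can be `φ`, and the flipped faces `l`. -/
inductive Sweep (N H : ℕ) (f γ : ℕ → ℕ) : ℕ → ℕ → (ℕ → ℕ) → List ℕ → Prop
  | start {φ : ℕ → ℕ} : (∀ a < N, φ a = f a) → Sweep N H f γ (H + 1) 0 φ []
  | down {c a : ℕ} {φ : ℕ → ℕ} {l : List ℕ} : a < N → Sweep N H f γ (c + 1) a φ l → γ a < φ a →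
      c ≤ φ a → Sweep N H f γ (c + 1) (a + 1) (Function.update φ a (φ a - 2)) (l ++ [a])
  | up {c a : ℕ} {φ : ℕ → ℕ} {l : List ℕ} : a < N → Sweep N H f γ (c + 1) a φ l → φ a < γ a →
      φ a ≤ H - c → Sweep N H f γ (c + 1) (a + 1) (Function.update φ a (φ a + 2)) (l ++ [a])
  | skip {c a : ℕ} {φ : ℕ → ℕ} {l : List ℕ} : a < N → Sweep N H f γ (c + 1) a φ l →
      (γ a < φ a → φ a < c) → (φ a < γ a → H - c < φ a) → Sweep N H f γ (c + 1) (a + 1) φ l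
  | next {c : ℕ} {φ : ℕ → ℕ} {l : List ℕ} : Sweep N H f γ (c + 1) N φ l → Sweep N H f γ c 0 φ l

/-- The branches of `flipBody` are only matched with the constructors of `Sweep`; no geometry
enters. -/
theorem sweep_spec (s : State) (k p t S N : ℕ) (f γ : ℕ → ℕ)
    (h0 : s.reg 0 = 0) (h7 : s.reg 7 = N)
    (h10 : s.reg 10 = S) (h11 : s.reg 11 = p + 2) (h12 : p + 3 * N ≤ s.reg 12)
    (h25 : s.reg 25 = t) (h30 : s.reg 30 = 1) (h31 : s.reg 31 = 3)
    (hi : ∀ a < N, s.mem (p + 3 * a) = a % (k + 1))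
    (hj : ∀ a < N, s.mem (p + 3 * a + 1) = a / (k + 1))
    (hγ : ∀ a < N, γ a = s.mem (s.reg 12 + 3 * a) + t)
    (hf : ∀ a < N, f a = s.mem (p + 3 * a + 2)) :
    Exec sweep s ((8 * S + 1) * (N * 40 + 10) + 10) (fun s' => ∃ φ l, Sweep N (8 * S) f γ 0 0 φ l ∧
      s'.out = s.out ++ l.flatMap fun a => [a % (k + 1), a / (k + 1)]) := by
  obtain ⟨q, hq⟩ : ∃ q, q = s.reg 12 := ⟨_, rfl⟩
  rw [← hq] at h12 hγ
  -- `R` ties the machine to the abstract pass. Only height cells of the first table change, so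
  -- coordinates and target heights can still be read off from `s`.
  obtain ⟨R, hR⟩ : ∃ R : (ℕ → ℕ) → List ℕ → State → Prop, R = fun φ l s' =>
    (∀ a < N, s'.mem (p + 3 * a + 2) = φ a) ∧
    (∀ x, (∀ a < N, x ≠ p + 3 * a + 2) → s'.mem x = s.mem x) ∧
    s'.out = s.out ++ l.flatMap fun a => [a % (k + 1), a / (k + 1)] := ⟨_, rfl⟩
  have hRstep : ∀ φ l a s' v, a < N → R φ l s' → R (Function.update φ a v) (l ++ [a])
      ⟨s'.reg, Function.update s'.mem (p + 2 + 3 * a) v,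
        s'.out ++ [a % (k + 1)] ++ [a / (k + 1)]⟩ := by
    intro φ l a s' v ha h
    rw [hR] at h ⊢
    obtain ⟨r1, r2, r3⟩ := h
    refine ⟨fun b hb => ?_, fun x hx => ?_, by simp [r3]⟩
    · by_cases hba : b = a
      · subst hba
        simp [Nat.add_right_comm]
      · dsimp only
        rw [Function.update_of_ne (by omega), Function.update_of_ne hba, r1 b hb]
    · dsimp only
      rw [Function.update_of_ne (by rw [Nat.add_right_comm]; exact hx a ha), r2 x hx]
  have hRreg : ∀ φ l s' s'', R φ l s' → s''.mem = s'.mem → s''.out = s'.out → R φ l s'' := by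
    intro φ l s' s'' h hm ho
    simp only [hR, hm, ho] at h ⊢
    exact h
  refine (Exec.seq (Exec.of_eval (Q := fun s' => s'.reg 35 = 8 * S ∧ s'.reg 36 = 8 * S + 1)
    rfl ?_) fun s₁ hf₁ h₁ => (Exec.loop (T := N * 40 + 9) (fun c s' => s'.reg 36 = c ∧
      ∃ φ l, Sweep N (8 * S) f γ c 0 φ l ∧ R φ l s') (fun n s' h => h.1) ?_ (n := 8 * S + 1) ?_).mono le_rfl
      (Q' := fun s' => ∃ φ l, Sweep N (8 * S) f γ 0 0 φ l ∧
        s'.out = s.out ++ l.flatMap fun a => [a % (k + 1), a / (k + 1)]) ?_).mono ?_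
    fun s' _ h => h
  · simp [eval, h10, h30]
    omega
  · rintro c s₂ hf₂ ⟨h36, φ₀, l₀, hJ₀, hR₀⟩
    have hc₂ : Consts s s₂ := (hf₁.consts rfl).trans (hf₂.consts rfl)
    have e35 := (hf₂.reg 35 rfl).trans h₁.1
    have e25 := (hf₂.reg 25 rfl).trans ((hf₁.reg 25 rfl).trans h25)
    have e0 := (hc₂ 0 (by decide)).trans h0
    have e7 := (hc₂ 7 (by decide)).trans h7
    have e11 := (hc₂ 11 (by decide)).trans h11
    have e12 := (hc₂ 12 (by decide)).trans hq.symm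
    have e30 := (hc₂ 30 (by decide)).trans h30
    have e31 := (hc₂ 31 (by decide)).trans h31
    refine (Exec.seq (Exec.of_eval (Q := fun s' => s'.reg 37 = c ∧ s'.reg 38 = 8 * S - c ∧
      s'.reg 27 = p + 2 ∧ s'.reg 28 = q ∧ s'.reg 29 = N) rfl ?_) fun s₃ hf₃ h₃ =>
      Exec.seq (Exec.loop (T := 39) (fun n s' => s'.reg 29 = n ∧ ∃ a φ l, a + n = N ∧
        s'.reg 27 = p + 2 + 3 * a ∧ s'.reg 28 = q + 3 * a ∧ Sweep N (8 * S) f γ (c + 1) a φ l ∧ R φ l s')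
        (fun n s' h => h.1) ?_ (n := N) ?_) fun s₄ hf₄ h₄ => Exec.of_eval rfl ?_).mono ?_
        fun s' _ h => h
    · simp [eval, h36, e0, e7, e11, e12, e30, e35]
    · rintro n s₄ hf₄ ⟨h29, a, φ, l, ha, h27, h28, hJa, hRa⟩
      have g25 := (hf₄.reg 25 rfl).trans ((hf₃.reg 25 rfl).trans e25)
      have g30 := (hf₄.reg 30 rfl).trans ((hf₃.reg 30 rfl).trans e30)
      have g31 := (hf₄.reg 31 rfl).trans ((hf₃.reg 31 rfl).trans e31)
      have g37 := (hf₄.reg 37 rfl).trans h₃.1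
      have g38 := (hf₄.reg 38 rfl).trans h₃.2.1
      have haN : a < N := by omega
      have hRa' := hRa
      rw [hR] at hRa'
      obtain ⟨r1, r2, -⟩ := hRa'
      have mf : s₄.mem (p + 2 + 3 * a) = φ a := by rw [Nat.add_right_comm, r1 a haN]
      have mg : s₄.mem (q + 3 * a) + t = γ a := by
        rw [hγ a haN, r2 _ (fun b hb => by omega)]
      have mj : s₄.mem (p + 2 + 3 * a - 1) = a / (k + 1) := by
        rw [← hj a haN, r2 _ (fun b hb => by omega)]
        congr 1
        omega
      have mi : s₄.mem (p + 2 + 3 * a - 1 - 1) = a % (k + 1) := by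
        rw [← hi a haN, r2 _ (fun b hb => by omega)]
        congr 1
        omega
      refine (Exec.of_eval (Q := fun s' => s'.reg 29 = n ∧ ∃ a φ l, a + n = N ∧
        s'.reg 27 = p + 2 + 3 * a ∧ s'.reg 28 = q + 3 * a ∧ Sweep N (8 * S) f γ (c + 1) a φ l ∧ R φ l s') rfl
        ?_).mono (show cost flipBody ≤ 39 by decide) fun s' _ h => h
      by_cases c1 : φ a - γ a = 0
      · by_cases c2 : γ a - φ a = 0
        · simp only [flipBody, eval, Function.update_self, Function.update_of_ne, ne_eq,
            Nat.reduceEqDiff, not_false_eq_true, g25, g30, g31, h27, h28, h29, mf, mg, c1, c2,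
            if_true]
          exact ⟨by omega, a + 1, φ, l, by omega, by omega, by omega,
            Sweep.skip haN hJa (by omega) (by omega), hRreg _ _ s₄ _ hRa rfl rfl⟩
        · by_cases c3 : φ a - (8 * S - c) = 0
          · simp only [flipBody, emitFace, eval, Function.update_self, Function.update_of_ne,
              ne_eq, Nat.reduceEqDiff, not_false_eq_true, g25, g30, g31, g38, h27, h28, h29, mf,
              mg, mi, mj, c1, c2, c3, if_true, if_false]
            exact ⟨by omega, a + 1, _, _, by omega, by omega, by omega,
              Sweep.up haN hJa (by omega) (by omega),
              hRreg _ _ _ _ (hRstep φ l a s₄ (φ a + 2) haN hRa) rfl rfl⟩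
          · simp only [flipBody, eval, Function.update_self, Function.update_of_ne, ne_eq,
              Nat.reduceEqDiff, not_false_eq_true, g25, g30, g31, g38, h27, h28, h29, mf, mg, c1,
              c2, c3, if_true, if_false]
            exact ⟨by omega, a + 1, φ, l, by omega, by omega, by omega,
              Sweep.skip haN hJa (by omega) (by omega), hRreg _ _ s₄ _ hRa rfl rfl⟩
      · by_cases c2 : c - φ a = 0
        · simp only [flipBody, emitFace, eval, Function.update_self, Function.update_of_ne,
            ne_eq, Nat.reduceEqDiff, not_false_eq_true, g25, g30, g31, g37, h27, h28, h29, mf,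
            mg, mi, mj, c1, c2, if_true, if_false]
          exact ⟨by omega, a + 1, _, _, by omega, by omega, by omega,
            Sweep.down haN hJa (by omega) (by omega),
            hRreg _ _ _ _ (hRstep φ l a s₄ (φ a - 2) haN hRa) rfl rfl⟩
        · simp only [flipBody, eval, Function.update_self, Function.update_of_ne, ne_eq,
            Nat.reduceEqDiff, not_false_eq_true, g25, g30, g31, g37, h27, h28, h29, mf, mg, c1,
            c2, if_false]
          exact ⟨by omega, a + 1, φ, l, by omega, by omega, by omega,
            Sweep.skip haN hJa (by omega) (by omega), hRreg _ _ s₄ _ hRa rfl rfl⟩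
    · exact ⟨h₃.2.2.2.2, 0, φ₀, l₀, by omega, h₃.2.2.1, h₃.2.2.2.1, hJ₀,
        hRreg _ _ s₂ _ hR₀ (hf₃.mem rfl) (hf₃.out rfl)⟩
    · obtain ⟨-, a, φ, l, ha, -, -, hJa, hRa⟩ := h₄
      obtain rfl : a = N := by omega
      have g36 := (hf₄.reg 36 rfl).trans ((hf₃.reg 36 rfl).trans h36)
      have g30 := (hf₄.reg 30 rfl).trans ((hf₃.reg 30 rfl).trans e30)
      exact ⟨by simp [eval, g36, g30], φ, l, Sweep.next hJa, hRreg _ _ s₄ _ hRa rfl rfl⟩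
    · simp only [cost]
      omega
  · refine ⟨h₁.2, fun a => s.mem (p + 3 * a + 2), [], .start fun a ha => (hf a ha).symm, ?_⟩
    rw [hR]
    exact ⟨fun a _ => by rw [hf₁.mem rfl], fun x _ => by rw [hf₁.mem rfl],
      by simp [hf₁.out rfl]⟩
  · rintro s' - ⟨-, φ, l, hJ', hR'⟩
    rw [hR] at hR'
    exact ⟨φ, l, hJ', hR'.2.2⟩
  · simp only [cost, Nat.add_assoc, Nat.reduceAdd]
    omega

/-! ### Assembling the parts of the program -/

theorem colHeight_congr {m m' : ℕ → ℕ} {k lp h j : ℕ}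
    (hm : ∀ j' < j, m (lp + j' * (k + 1)) = m' (lp + j' * (k + 1))) :
    colHeight m k lp h j = colHeight m' k lp h j := by
  induction j with
  | zero => rfl
  | succ j ih =>
    rw [colHeight, colHeight, ih fun j' hj' => hm j' (by omega), hm j (by omega)]

theorem height_congr {m m' : ℕ → ℕ} {k zp lp d h i j : ℕ}
    (hz : ∀ i' < i, m (zp + j * k + i') = m' (zp + j * k + i'))
    (hl : ∀ j' < j, m (lp + j' * (k + 1)) = m' (lp + j' * (k + 1))) :
    tableHeight m k zp lp d h i j = tableHeight m' k zp lp d h i j := by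
  induction i with
  | zero => exact colHeight_congr hl
  | succ i ih => rw [tableHeight, tableHeight, ih fun i' hi' => hz i' (by omega), hz i (by omega)]

theorem div_le_of_lt_mul {a k l : ℕ} (ha : a < (l + 1) * (k + 1)) : a / (k + 1) ≤ l :=
  Nat.lt_succ_iff.1 (Nat.div_lt_of_lt_mul (by rwa [mul_comm] at ha))

theorem mul_add_lt {i j k l : ℕ} (hj : j ≤ l) (hi : i < k) : j * k + i < (l + 1) * k := by
  have := Nat.mul_le_mul_right k hj
  rw [Nat.succ_mul]
  omega

/-- A bound for the number of steps of the program. -/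
def steps (l N S : ℕ) : ℕ :=
  9 + ((l + 1) * 4 + 1 + (9 + (10 + (N * 29 + 1 + (9 + (N * 29 + 1 + (3 +
    (N * 11 + 2 * S * (N * 11 + 14) + 11 + ((8 * S + 1) * (N * 40 + 10) + 10)))))))))

-- Memory layout: three header cells, two blocks of `M` crease bits, and from `p` and `q` on the two
-- tables with three cells per face.
set_option maxHeartbeats 1000000 in
theorem program_spec (s : State) (k l d Z N M S p q : ℕ) (hreg : ∀ r, s.reg r = 0)
    (hout : s.out = []) (hk : s.mem 0 = k) (hl : s.mem 1 = l) (hd : s.mem 2 = d)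
    (hZ : Z = (l + 1) * k) (hN : N = (l + 1) * (k + 1)) (hM : M = Z + l * (k + 1))
    (hS : S = k + l + 2) (hp : p = 2 * M + 4) (hq : q = p + 3 * N) (f g : ℕ → ℕ)
    (hf : ∀ a < N, f a = tableHeight s.mem k 3 (3 + Z) d (4 * S) (a % (k + 1)) (a / (k + 1)))
    (hg : ∀ a < N,
      g a = tableHeight s.mem k (3 + M) (3 + M + Z) d (2 * S) (a % (k + 1)) (a / (k + 1))) :
    Exec program s (steps l N S) (fun s' => ∃ u ≤ 2 * S,
      (∀ u' ≤ 2 * S,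
        ∑ a ∈ Finset.range N, ((f a - (g a + 2 * u)) + (g a + 2 * u - f a)) ≤
        ∑ a ∈ Finset.range N, ((f a - (g a + 2 * u')) + (g a + 2 * u' - f a))) ∧
      ∃ φ L, Sweep N (8 * S) f (fun a => g a + 2 * u) 0 0 φ L ∧
        s'.out = L.flatMap fun a => [a % (k + 1), a / (k + 1)]) := by
  have hN' : N = l * (k + 1) + (k + 1) := by rw [hN, Nat.succ_mul]
  have hzp : ∀ a < N, a % (k + 1) < k → a / (k + 1) * k + a % (k + 1) < Z := fun a ha h =>
    hZ ▸ mul_add_lt (div_le_of_lt_mul (hN ▸ ha)) h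
  have hlp : ∀ a < N, a / (k + 1) * (k + 1) ≤ l * (k + 1) := fun a ha =>
    Nat.mul_le_mul_right _ (div_le_of_lt_mul (hN ▸ ha))
  refine Exec.seq (Exec.of_eval (Q := fun s' => s'.reg 1 = k ∧ s'.reg 3 = d ∧ s'.reg 4 = k + 1 ∧
      s'.reg 5 = l + 1 ∧ s'.reg 8 = l + 1 ∧ s'.reg 30 = 1 ∧ s'.reg 31 = 3) rfl ?_) fun s₁ f₁ r₁ =>
    Exec.seq (((countLoop_spec s₁ ?_ ?_ r₁.2.2.2.2.2.1)).mono (T' := (l + 1) * 4 + 1)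
      (Q' := fun s' => s'.reg 6 = Z ∧ s'.reg 7 = N) ?_ ?_) fun s₂ f₂ r₂ =>
    Exec.seq (Exec.of_eval (Q := fun s' => s'.reg 9 = M ∧ s'.reg 10 = S ∧ s'.reg 11 = p ∧
      s'.reg 12 = q) rfl ?_) fun s₃ f₃ r₃ => ?_
  · simp [readSizes, eval, hreg, hk, hl, hd]
  · rw [f₁.reg 6 rfl, hreg]
  · rw [f₁.reg 7 rfl, hreg]
  · rw [r₁.2.2.2.2.1]
  · rintro s' - ⟨h6, h7⟩
    rw [h6, h7, r₁.2.2.2.2.1, r₁.1, r₁.2.2.1, hZ, hN]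
    exact ⟨rfl, rfl⟩
  · have e4 := (f₂.reg 4 rfl).trans r₁.2.2.1
    have e5 := (f₂.reg 5 rfl).trans r₁.2.2.2.1
    have e30 := (f₂.reg 30 rfl).trans r₁.2.2.2.2.2.1
    have e31 := (f₂.reg 31 rfl).trans r₁.2.2.2.2.2.2
    simp only [layout, eval, Function.update_self, Function.update_of_ne, ne_eq,
      Nat.reduceEqDiff, not_false_eq_true, e4, e5, e30, e31, r₂]
    omega
  have m₃ : s₃.mem = s.mem := (f₃.mem rfl).trans ((f₂.mem rfl).trans (f₁.mem rfl))
  have o₃ : s₃.out = [] := ((f₃.out rfl).trans ((f₂.out rfl).trans (f₁.out rfl))).trans hout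
  have e0 : s₃.reg 0 = 0 := (f₃.reg 0 rfl).trans ((f₂.reg 0 rfl).trans
    ((f₁.reg 0 rfl).trans (hreg 0)))
  have e1 : s₃.reg 1 = k := (f₃.reg 1 rfl).trans ((f₂.reg 1 rfl).trans r₁.1)
  have e3 : s₃.reg 3 = d := (f₃.reg 3 rfl).trans ((f₂.reg 3 rfl).trans r₁.2.1)
  have e4 : s₃.reg 4 = k + 1 := (f₃.reg 4 rfl).trans ((f₂.reg 4 rfl).trans r₁.2.2.1)
  have e30 : s₃.reg 30 = 1 := (f₃.reg 30 rfl).trans ((f₂.reg 30 rfl).trans r₁.2.2.2.2.2.1)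
  have e31 : s₃.reg 31 = 3 := (f₃.reg 31 rfl).trans ((f₂.reg 31 rfl).trans r₁.2.2.2.2.2.2)
  have e6 : s₃.reg 6 = Z := (f₃.reg 6 rfl).trans r₂.1
  have e7 : s₃.reg 7 = N := (f₃.reg 7 rfl).trans r₂.2
  obtain ⟨e9, e10, e11, e12⟩ := r₃
  refine Exec.seq (Exec.of_eval (Q := fun s' => s'.reg 13 = 3 ∧ s'.reg 14 = 3 + Z ∧
      s'.reg 15 = 4 * S ∧ s'.reg 16 = p ∧ s'.reg 17 = d ∧ s'.reg 18 = N ∧ s'.reg 19 = 0 ∧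
      s'.reg 20 = 0 ∧ s'.reg 21 = 4 * S) rfl ?_) fun s₄ f₄ ⟨a13, a14, a15, a16, a17, a18, a19, a20, a21⟩ =>
    Exec.seq ((heightLoop_spec s₄ k N 3 (3 + Z) (4 * S) d p ((f₄.reg 0 rfl).trans e0)
      ((f₄.reg 1 rfl).trans e1) ((f₄.reg 4 rfl).trans e4) ((f₄.reg 30 rfl).trans e30)
      a13 a14 a15 a16 a17 a18 a19 a20 a21 ?_ ?_)) fun s₅ f₅ r₅ => ?_
  · simp only [prepareFirst, resetHeights, eval, Function.update_self, Function.update_of_ne,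
      ne_eq, Nat.reduceEqDiff, not_false_eq_true, e0, e3, e6, e7, e10, e11, e31,
      add_zero, true_and, and_self]
    omega
  · intro a ha h
    have := hzp a ha h
    omega
  · intro a ha
    have := hlp a ha
    omega
  rw [f₄.mem rfl, m₃] at r₅
  obtain ⟨m₅, r₅⟩ := r₅
  have c₅ : Consts s₃ s₅ := (f₄.consts rfl).trans (f₅.consts rfl)
  refine Exec.seq (Exec.of_eval (Q := fun s' => s'.reg 13 = 3 + M ∧ s'.reg 14 = 3 + M + Z ∧
      s'.reg 15 = 2 * S ∧ s'.reg 16 = q ∧ s'.reg 17 = d ∧ s'.reg 18 = N ∧ s'.reg 19 = 0 ∧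
      s'.reg 20 = 0 ∧ s'.reg 21 = 2 * S) rfl ?_) fun s₆ f₆ ⟨b13, b14, b15, b16, b17, b18, b19, b20, b21⟩ => ?_
  · have g0 := (c₅ 0 (by decide)).trans e0
    have g3 := (c₅ 3 (by decide)).trans e3
    have g6 := (c₅ 6 (by decide)).trans e6
    have g7 := (c₅ 7 (by decide)).trans e7
    have g9 := (c₅ 9 (by decide)).trans e9
    have g10 := (c₅ 10 (by decide)).trans e10
    have g12 := (c₅ 12 (by decide)).trans e12
    have g31 := (c₅ 31 (by decide)).trans e31
    simp only [prepareSecond, resetHeights, eval, Function.update_self, Function.update_of_ne,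
      ne_eq, Nat.reduceEqDiff, not_false_eq_true, g0, g3, g6, g7, g9, g10, g12, g31,
      add_zero, true_and, and_self]
    omega
  have c₆ : Consts s₃ s₆ := c₅.trans (f₆.consts rfl)
  refine Exec.seq ((heightLoop_spec s₆ k N (3 + M) (3 + M + Z) (2 * S) d q
      ((c₆ 0 (by decide)).trans e0) ((c₆ 1 (by decide)).trans e1) ((c₆ 4 (by decide)).trans e4)
      ((c₆ 30 (by decide)).trans e30) b13 b14 b15 b16 b17 b18 b19 b20 b21 ?_ ?_))
      fun s₇ f₇ r₇ => ?_
  · intro a ha h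
    have := hzp a ha h
    omega
  · intro a ha
    have := hlp a ha
    omega
  rw [f₆.mem rfl] at r₇
  obtain ⟨m₇, r₇⟩ := r₇
  have c₇ : Consts s₃ s₇ := c₆.trans (f₇.consts rfl)
  -- The table pointers move from the first coordinate of a record to its height.
  refine Exec.seq (Exec.of_eval (Q := fun s' => s'.reg 11 = p + 2 ∧ s'.reg 12 = q + 2) rfl ?_)
    fun s₈ f₈ ⟨i11, i12⟩ => ?_
  · simp [eval, (c₇ 11 (by decide)).trans e11, (c₇ 12 (by decide)).trans e12,
      (c₇ 30 (by decide)).trans e30]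
  have m₈ : s₈.mem = s₇.mem := f₈.mem rfl
  have i0 := (f₈.reg 0 rfl).trans ((c₇ 0 (by decide)).trans e0)
  have i7 := (f₈.reg 7 rfl).trans ((c₇ 7 (by decide)).trans e7)
  have i10 := (f₈.reg 10 rfl).trans ((c₇ 10 (by decide)).trans e10)
  have i30 := (f₈.reg 30 rfl).trans ((c₇ 30 (by decide)).trans e30)
  have i31 := (f₈.reg 31 rfl).trans ((c₇ 31 (by decide)).trans e31)
  have hf' : ∀ a < N, f a = s₈.mem (p + 3 * a + 2) := by
    intro a ha
    rw [m₈, m₇ _ (by omega), (r₅ a ha).2.2, hf a ha]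
  have hg' : ∀ a < N, g a = s₈.mem (q + 3 * a + 2) := by
    intro a ha
    rw [m₈, (r₇ a ha).2.2, hg a ha]
    have hi := Nat.mod_lt a (show 0 < k + 1 by omega)
    have hj : a / (k + 1) ≤ l := div_le_of_lt_mul (hN ▸ ha)
    -- The second scan runs on memory that already contains the first table, but it reads only input
    -- cells, which that table does not touch.
    apply height_congr
    · intro i' hi'
      have := mul_add_lt hj (show i' < k by omega)
      rw [m₅]
      omega
    · intro j' hj'
      have := Nat.mul_le_mul_right (k + 1) (hj'.le.trans hj)
      rw [m₅]
      omega
  have hsum : ∀ t, heightSum s₈.mem N (p + 2) (q + 2) t =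
      ∑ a ∈ Finset.range N, ((f a - (g a + t)) + (g a + t - f a)) := by
    intro t
    refine Finset.sum_congr rfl fun a ha => ?_
    rw [hf' a (Finset.mem_range.1 ha), hg' a (Finset.mem_range.1 ha), Nat.add_right_comm p,
      Nat.add_right_comm q]
  refine Exec.seq ((search_spec s₈ i0 i30 i31).mono (T' := N * 11 + 2 * S * (N * 11 + 14) + 11)
    (le_of_eq (by rw [i7, i10])) fun s' _ h => h) fun s₉ f₉ ⟨u, hu, h25, hmin⟩ => ?_
  rw [i10] at hu hmin
  simp only [i7, i11, i12, hsum] at hmin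
  have m₉ : s₉.mem = s₈.mem := f₉.mem rfl
  refine (sweep_spec s₉ k p (2 * u) S N f (fun a => g a + 2 * u) ((f₉.reg 0 rfl).trans i0)
    ((f₉.reg 7 rfl).trans i7) ((f₉.reg 10 rfl).trans i10) ((f₉.reg 11 rfl).trans i11)
    ?_ h25 ((f₉.reg 30 rfl).trans i30) ((f₉.reg 31 rfl).trans i31) ?_ ?_ ?_ ?_).mono le_rfl
    fun s' _ ⟨φ, L, hL, ho⟩ => ⟨u, hu, hmin, φ, L, hL, ?_⟩
  · rw [f₉.reg 12 rfl, i12]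
    omega
  · intro a ha
    rw [m₉, m₈, m₇ _ (by omega), (r₅ a ha).1]
  · intro a ha
    rw [m₉, m₈, m₇ _ (by omega), (r₅ a ha).2.1]
  · intro a ha
    rw [m₉, f₉.reg 12 rfl, i12, hg' a ha, Nat.add_right_comm q]
  · intro a ha
    rw [m₉, hf' a ha]
  · rw [ho, f₉.out rfl, f₈.out rfl, f₇.out rfl, f₆.out rfl, f₅.out rfl, f₄.out rfl, o₃,
      List.nil_append]

end MinFlip

end RAM

namespace MiuraFlip.Miura

open scoped BigOperators

variable {P : Miura}

/-! ### Faces in the order of the program -/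

/-- The number of a face, row by row. -/
def faceIndex (v : P.Face) : ℕ := v.2 * (P.zigzags + 1) + v.1

/-- The face with a given number. -/
def faceOf (P : Miura) (a : ℕ) : P.Face :=
  (Fin.ofNat (P.zigzags + 1) a, Fin.ofNat (P.lines + 1) (a / (P.zigzags + 1)))

theorem faceIndex_mod (v : P.Face) : faceIndex v % (P.zigzags + 1) = v.1 := by
  rw [faceIndex, mul_comm, Nat.mul_add_mod, Nat.mod_eq_of_lt v.1.2]

theorem faceIndex_div (v : P.Face) : faceIndex v / (P.zigzags + 1) = v.2 := by
  rw [faceIndex, mul_comm, Nat.mul_add_div (by omega), Nat.div_eq_of_lt v.1.2, add_zero]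

theorem faceIndex_lt (v : P.Face) : faceIndex v < (P.lines + 1) * (P.zigzags + 1) :=
  RAM.MinFlip.mul_add_lt (Nat.lt_succ_iff.1 v.2.2) v.1.2

theorem faceOf_faceIndex (v : P.Face) : faceOf P (faceIndex v) = v := by
  rw [faceOf, faceIndex_div]
  refine Prod.ext (Fin.ext ?_) (Fin.ext ?_)
  · exact faceIndex_mod v
  · exact Nat.mod_eq_of_lt v.2.2

theorem faceOf_snd {a : ℕ} (ha : a < (P.lines + 1) * (P.zigzags + 1)) :
    ((faceOf P a).2 : ℕ) = a / (P.zigzags + 1) :=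
  Nat.mod_eq_of_lt (Nat.lt_succ_iff.2 (RAM.MinFlip.div_le_of_lt_mul ha))

theorem faceIndex_faceOf {a : ℕ} (ha : a < (P.lines + 1) * (P.zigzags + 1)) :
    faceIndex (faceOf P a) = a := by
  rw [faceIndex, faceOf_snd ha]
  exact Nat.div_add_mod' a (P.zigzags + 1)

theorem faceIndex_eq_iff {a : ℕ} (ha : a < (P.lines + 1) * (P.zigzags + 1)) (v : P.Face) :
    faceIndex v = a ↔ v = faceOf P a := by
  constructor
  · rintro rfl
    rw [faceOf_faceIndex]
  · rintro rfl
    exact faceIndex_faceOf ha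

theorem sum_range_eq_sum_face {M : Type*} [AddCommMonoid M] (φ : ℕ → M) :
    ∑ a ∈ Finset.range ((P.lines + 1) * (P.zigzags + 1)), φ a = ∑ v : P.Face, φ (faceIndex v) := by
  refine Finset.sum_bij' (fun a _ => faceOf P a) (fun v _ => faceIndex v) ?_ ?_ ?_ ?_ ?_
  · simp
  · exact fun v _ => Finset.mem_range.2 (faceIndex_lt v)
  · exact fun a ha => faceIndex_faceOf (Finset.mem_range.1 ha)
  · exact fun v _ => faceOf_faceIndex v
  · exact fun a ha => by rw [faceIndex_faceOf (Finset.mem_range.1 ha)]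

theorem encodeFaces_map {l : List ℕ} (hl : ∀ a ∈ l, a < (P.lines + 1) * (P.zigzags + 1)) :
    encodeFaces (l.map (faceOf P)) =
      l.flatMap fun a => [a % (P.zigzags + 1), a / (P.zigzags + 1)] := by
  rw [encodeFaces, List.flatMap_map]
  refine List.flatMap_congr fun a ha => ?_
  rw [faceOf_snd (hl a ha)]
  rfl

/-! ### Correctness of the sweep -/

theorem update_comp_faceIndex (φ : ℕ → ℕ) {a : ℕ} (ha : a < (P.lines + 1) * (P.zigzags + 1))
    (x : ℕ) : (fun v : P.Face => ((Function.update φ a x (faceIndex v) : ℕ) : ℤ)) =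
      Function.update (fun v => (φ (faceIndex v) : ℤ)) (faceOf P a) x := by
  funext v
  by_cases hv : v = faceOf P a
  · rw [hv, Function.update_self, faceIndex_faceOf ha, Function.update_self]
  · rw [Function.update_of_ne hv, Function.update_of_ne ((faceIndex_eq_iff ha v).not.2 hv)]

/-- Faces above their target are at most on the current level `c - 1`, and strictly below it once
visited; faces below their target satisfy the mirror image in `H`. Hence a face that is flipped down
is highest among those that are too high, as `IsPotential.flip_toward` requires. Even differences
prevent overshooting, so downward and upward flips do not interfere. -/
theorem sweep_invariant {μ ν : P.MV} {N H : ℕ} {f γ : ℕ → ℕ}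
    (hN : N = (P.lines + 1) * (P.zigzags + 1))
    (hf : IsPotential μ fun v => (f (faceIndex v) : ℤ))
    (hγ : IsPotential ν fun v => (γ (faceIndex v) : ℤ))
    (heven : ∀ v : P.Face, Even ((f (faceIndex v) : ℤ) - γ (faceIndex v)))
    (hfH : ∀ a < N, f a ≤ H) (hγH : ∀ a < N, γ a ≤ H) {c a : ℕ} {φ : ℕ → ℕ} {l : List ℕ}
    (h : RAM.MinFlip.Sweep N H f γ c a φ l) :
    (∃ μ', IsFlipSequence μ' μ (l.map (faceOf P)) ∧
      IsPotential μ' fun v => (φ (faceIndex v) : ℤ)) ∧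
    (∀ v : P.Face, Even ((φ (faceIndex v) : ℤ) - γ (faceIndex v))) ∧
    ∑ v : P.Face, |(φ (faceIndex v) : ℤ) - γ (faceIndex v)| + 2 * l.length =
      ∑ v : P.Face, |(f (faceIndex v) : ℤ) - γ (faceIndex v)| ∧
    (∀ b < N, γ b < φ b → φ b + 1 ≤ c ∧ (b < a → φ b + 2 ≤ c)) ∧
    (∀ b < N, φ b < γ b → H + 1 ≤ φ b + c ∧ (b < a → H + 2 ≤ φ b + c)) ∧
    ∀ b ∈ l, b < N := by
  induction h with
  | @start φ h =>
    have hφ : ∀ v : P.Face, φ (faceIndex v) = f (faceIndex v) := fun v =>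
      h _ (hN ▸ faceIndex_lt v)
    simp only [hφ]
    refine ⟨⟨μ, ⟨hf.locallyValid, rfl⟩, hf⟩, heven, by simp, fun b hb _ => ?_, fun b hb h' => ?_,
      by simp⟩
    · have := hfH b hb
      rw [h b hb]
      omega
    · omega
  | @down c a φ l ha _ h1 h2 ih =>
    obtain ⟨⟨μ', hl, hφ⟩, hev, hsum, hup, hlow, hmem⟩ := ih
    subst hN
    have hx : ((φ a - 2 : ℕ) : ℤ) = (fun v => (φ (faceIndex v) : ℤ)) (faceOf P a) - 2 * 1 := by
      obtain ⟨r, hr⟩ := hev (faceOf P a)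
      simp only [faceIndex_faceOf ha] at hr ⊢
      omega
    obtain ⟨t1, t2, t3⟩ := hφ.flip_toward hγ (ε := 1) (F := faceOf P a) (Or.inl rfl) hev
      (by simp only [faceIndex_faceOf ha]; omega) (fun u hu => by
        -- No face above its target is higher than `c`, and `c ≤ φ a`.
        have := (hup _ (faceIndex_lt u) (by omega)).1
        simp only [faceIndex_faceOf ha]
        omega)
    rw [← hx, ← update_comp_faceIndex φ ha] at t1 t3
    refine ⟨⟨_, ?_, t1⟩, ?_, ?_, ?_, ?_, ?_⟩
    · rw [List.map_append]
      exact hl.append t1.locallyValid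
    · rw [← hx, ← update_comp_faceIndex φ ha] at t2
      exact t2
    · rw [List.length_append, List.length_singleton]
      push_cast
      linarith
    · intro b hb hlt
      by_cases hba : b = a
      · subst hba
        rw [Function.update_self] at hlt ⊢
        have := (hup b hb h1).1
        omega
      · rw [Function.update_of_ne hba] at hlt ⊢
        have := hup b hb hlt
        exact ⟨this.1, fun h => this.2 (by omega)⟩
    · intro b hb hlt
      by_cases hba : b = a
      · subst hba
        -- The excess was even and positive, so the lowered face cannot be below its target.
        obtain ⟨r, hr⟩ := hev (faceOf P b)
        rw [Function.update_self] at hlt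
        rw [faceIndex_faceOf ha] at hr
        omega
      · rw [Function.update_of_ne hba] at hlt ⊢
        have := hlow b hb hlt
        exact ⟨this.1, fun h => this.2 (by omega)⟩
    · simp only [List.mem_append, List.mem_singleton]
      rintro b (hb | rfl)
      exacts [hmem b hb, ha]
  | @up c a φ l ha _ h1 h2 ih =>
    obtain ⟨⟨μ', hl, hφ⟩, hev, hsum, hup, hlow, hmem⟩ := ih
    subst hN
    have hx : ((φ a + 2 : ℕ) : ℤ) =
        (fun v => (φ (faceIndex v) : ℤ)) (faceOf P a) - 2 * -1 := by
      simp only [faceIndex_faceOf ha]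
      omega
    obtain ⟨t1, t2, t3⟩ := hφ.flip_toward hγ (ε := -1) (F := faceOf P a) (Or.inr rfl) hev
      (by simp only [faceIndex_faceOf ha]; omega) (fun u hu => by
        have := (hlow _ (faceIndex_lt u) (by omega)).1
        simp only [faceIndex_faceOf ha]
        omega)
    rw [← hx, ← update_comp_faceIndex φ ha] at t1 t3
    refine ⟨⟨_, ?_, t1⟩, ?_, ?_, ?_, ?_, ?_⟩
    · rw [List.map_append]
      exact hl.append t1.locallyValid
    · rw [← hx, ← update_comp_faceIndex φ ha] at t2
      exact t2
    · rw [List.length_append, List.length_singleton]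
      push_cast
      linarith
    · intro b hb hlt
      by_cases hba : b = a
      · subst hba
        obtain ⟨r, hr⟩ := hev (faceOf P b)
        rw [Function.update_self] at hlt
        rw [faceIndex_faceOf ha] at hr
        omega
      · rw [Function.update_of_ne hba] at hlt ⊢
        have := hup b hb hlt
        exact ⟨this.1, fun h => this.2 (by omega)⟩
    · intro b hb hlt
      by_cases hba : b = a
      · subst hba
        rw [Function.update_self] at hlt ⊢
        have := (hlow b hb h1).1
        omega
      · rw [Function.update_of_ne hba] at hlt ⊢
        have := hlow b hb hlt
        exact ⟨this.1, fun h => this.2 (by omega)⟩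
    · simp only [List.mem_append, List.mem_singleton]
      rintro b (hb | rfl)
      exacts [hmem b hb, ha]
  | @skip c a φ l ha _ h1 h2 ih =>
    obtain ⟨hl, hev, hsum, hup, hlow, hmem⟩ := ih
    refine ⟨hl, hev, hsum, fun b hb hlt => ⟨(hup b hb hlt).1, fun hb' => ?_⟩,
      fun b hb hlt => ⟨(hlow b hb hlt).1, fun hb' => ?_⟩, hmem⟩
    · by_cases hba : b = a
      · subst hba
        have := h1 hlt
        omega
      · exact (hup b hb hlt).2 (by omega)
    · by_cases hba : b = a
      · subst hba
        have := h2 hlt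
        omega
      · exact (hlow b hb hlt).2 (by omega)
  | @next c φ l _ ih =>
    obtain ⟨hl, hev, hsum, hup, hlow, hmem⟩ := ih
    refine ⟨hl, hev, hsum, fun b hb hlt => ?_, fun b hb hlt => ?_, hmem⟩
    · have := (hup b hb hlt).2 hb
      omega
    · have := (hlow b hb hlt).2 hb
      omega

/-- At index `0` the invariant leaves no face above its target, and a face below its target would
have a height exceeding `H`. -/
theorem isFlipSequence_of_sweep {μ ν : P.MV} {N H : ℕ} {f γ φ : ℕ → ℕ} {l : List ℕ}
    (hN : N = (P.lines + 1) * (P.zigzags + 1))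
    (hf : IsPotential μ fun v => (f (faceIndex v) : ℤ))
    (hγ : IsPotential ν fun v => (γ (faceIndex v) : ℤ))
    (heven : ∀ v : P.Face, Even ((f (faceIndex v) : ℤ) - γ (faceIndex v)))
    (hfH : ∀ a < N, f a ≤ H) (hγH : ∀ a < N, γ a ≤ H)
    (h : RAM.MinFlip.Sweep N H f γ 0 0 φ l) :
    IsFlipSequence ν μ (l.map (faceOf P)) ∧
      2 * (l.length : ℤ) = ∑ v : P.Face, |(f (faceIndex v) : ℤ) - γ (faceIndex v)| ∧
      ∀ b ∈ l, b < N := by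
  obtain ⟨⟨μ', hl, hφ⟩, hev, hsum, hup, hlow, hmem⟩ :=
    sweep_invariant hN hf hγ heven hfH hγH h
  have heq : ∀ b < N, φ b = γ b := by
    intro b hb
    rcases lt_trichotomy (φ b) (γ b) with h | h | h
    · have := hlow b hb h
      have := hγH b hb
      omega
    · exact h
    · have := hup b hb h
      omega
  have heq' : ∀ v : P.Face, φ (faceIndex v) = γ (faceIndex v) := fun v =>
    heq _ (hN ▸ faceIndex_lt v)
  simp only [heq'] at hφ hsum
  obtain rfl := hφ.unique hγ
  refine ⟨hl, ?_, hmem⟩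
  simp only [sub_self, abs_zero, Finset.sum_const_zero, zero_add] at hsum
  exact hsum

/-! ### The input of the program -/

/-- The input bit of a sign. -/
def signBit (s : ℤˣ) : ℕ := if s = 1 then 1 else 0

theorem signBit_eq (s : ℤˣ) : (s : ℤ) = 2 * signBit s - 1 := by
  rcases Int.units_eq_one_or s with rfl | rfl <;> rfl

theorem signBit_le (s : ℤˣ) : signBit s ≤ 1 := by
  unfold signBit
  split_ifs <;> omega

/-- The number of creases. -/
def creases (P : Miura) : ℕ :=
  (P.lines + 1) * P.zigzags + P.lines * (P.zigzags + 1)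

theorem length_encodeMV (μ : P.MV) : (encodeMV μ).length = creases P := by
  simp [encodeMV, creases]

theorem length_encodeInput (μ ν : P.MV) : (encodeInput μ ν).length = 2 * creases P + 3 := by
  simp only [encodeInput, List.length_append, length_encodeMV, List.length_cons, List.length_nil]
  omega

theorem finProdFinEquiv_symm_mk {m n i j : ℕ} (hi : i < n) (hj : j < m) (h : j * n + i < m * n) :
    finProdFinEquiv.symm (⟨j * n + i, h⟩ : Fin (m * n)) = (⟨j, hj⟩, ⟨i, hi⟩) := by
  rw [Equiv.symm_apply_eq]
  ext
  simp only [finProdFinEquiv_apply_val]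
  ring

theorem encodeMV_zig (μ : P.MV) (i : Fin P.zigzags) (j : Fin (P.lines + 1)) :
    (encodeMV μ).getD (j * P.zigzags + i) 0 = signBit (μ (.zig i j)) := by
  have h : (j : ℕ) * P.zigzags + i < (P.lines + 1) * P.zigzags :=
    RAM.MinFlip.mul_add_lt (Nat.lt_succ_iff.1 j.2) i.2
  rw [encodeMV, List.getD_append _ _ _ _ (by simpa using h),
    List.getD_eq_getElem _ _ (by simpa using h), List.getElem_ofFn]
  rw [finProdFinEquiv_symm_mk i.2 j.2]
  rfl

theorem encodeMV_line (μ : P.MV) (i : Fin (P.zigzags + 1)) (j : Fin P.lines) :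
    (encodeMV μ).getD ((P.lines + 1) * P.zigzags + (j * (P.zigzags + 1) + i)) 0 =
      signBit (μ (.line i j)) := by
  have h : (j : ℕ) * (P.zigzags + 1) + i < P.lines * (P.zigzags + 1) := by
    have := RAM.MinFlip.mul_add_lt (l := P.lines - 1) (show (j : ℕ) ≤ P.lines - 1 by omega) i.2
    rwa [Nat.sub_add_cancel P.lines_pos] at this
  rw [encodeMV, List.getD_append_right _ _ _ _ (by simp)]
  simp only [List.length_ofFn, Nat.add_sub_cancel_left]
  rw [List.getD_eq_getElem _ _ (by simpa using h), List.getElem_ofFn]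
  rw [finProdFinEquiv_symm_mk i.2 j.2]
  rfl

theorem encodeInput_first (μ ν : P.MV) {a : ℕ} (ha : a < creases P) :
    (encodeInput μ ν).getD (3 + a) 0 = (encodeMV μ).getD a 0 := by
  rw [encodeInput, List.getD_append _ _ _ _ (by simpa [length_encodeMV] using by omega),
    List.getD_append_right _ _ _ _ (by simp)]
  simp

theorem encodeInput_second (μ ν : P.MV) (a : ℕ) :
    (encodeInput μ ν).getD (3 + creases P + a) 0 = (encodeMV ν).getD a 0 := by
  rw [encodeInput, List.getD_append_right _ _ _ _ (by simp [length_encodeMV]; omega)]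
  congr 1
  simp [length_encodeMV]
  omega

/-! ### The heights computed by the program -/

open RAM.MinFlip

theorem rowBit_spec (j : ℕ) :
    rowBit (if P.shift < 0 then 1 else 0) j ≤ 1 ∧
      P.rowDirection j = 2 * rowBit (if P.shift < 0 then 1 else 0) j - 1 := by
  induction j with
  | zero => by_cases h : P.shift < 0 <;> simp [rowBit, rowDirection, h]
  | succ j ih =>
    rw [rowBit, rowDirection_succ]
    omega

/-- A product of signs is `1` exactly when the bits agree; the bracket is the distance of the bits.
-/
theorem rowDirection_mul_signBit {r : ℕ} {ρ : ℤ} (hr : r ≤ 1) (hρ : ρ = 2 * r - 1) (s : ℤˣ) :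
    ρ * (s : ℤ) = 1 - 2 * ((signBit s - r) + (r - signBit s) : ℕ) := by
  have h := signBit_le s
  rw [signBit_eq, hρ]
  generalize signBit s = b at h ⊢
  interval_cases r <;> interval_cases b <;> rfl

/-- A height drops by at most one per crease, so the base `h` is large enough that no subtraction is
truncated. Only the first column of line creases is read; `LocallyValid.isPotential` gives the
others. -/
theorem height_spec {μ : P.MV} (hμ : LocallyValid μ) (m : ℕ → ℕ) (zp lp h : ℕ)
    (hh : P.zigzags + P.lines + 1 ≤ h)
    (hz : ∀ (i : Fin P.zigzags) (j : Fin (P.lines + 1)),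
      m (zp + (j * P.zigzags + i)) = signBit (μ (.zig i j)))
    (hl : ∀ j : Fin P.lines, m (lp + j * (P.zigzags + 1)) = signBit (μ (.line 0 j))) :
    (IsPotential μ fun v => ((tableHeight m P.zigzags zp lp (if P.shift < 0 then 1 else 0) h
      v.1 v.2 : ℕ) : ℤ)) ∧
    ∀ i ≤ P.zigzags, ∀ j ≤ P.lines,
      tableHeight m P.zigzags zp lp (if P.shift < 0 then 1 else 0) h i j ≤ h + i + j := by
  obtain ⟨d, hd⟩ : ∃ d, d = if P.shift < 0 then 1 else 0 := ⟨_, rfl⟩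
  have hrow := rowBit_spec (P := P)
  simp only [← hd] at hrow ⊢
  have hcol : ∀ j ≤ P.lines, h ≤ colHeight m P.zigzags lp h j + j ∧
      colHeight m P.zigzags lp h j ≤ h + j := by
    intro j
    induction j with
    | zero => exact fun _ => by simp [colHeight]
    | succ j ih =>
      intro hj
      have := ih (by omega)
      have hb := hl ⟨j, by omega⟩
      have hb' := signBit_le (μ (.line 0 ⟨j, by omega⟩))
      dsimp only at hb
      rw [colHeight, hb]
      omega
  have hheight : ∀ j ≤ P.lines, ∀ i ≤ P.zigzags,
      h ≤ tableHeight m P.zigzags zp lp d h i j + i + j ∧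
      tableHeight m P.zigzags zp lp d h i j ≤ h + i + j := by
    intro j hj i
    induction i with
    | zero => exact fun _ => by simpa [tableHeight] using hcol j hj
    | succ i ih =>
      intro hi
      have := ih (by omega)
      have hb := hz ⟨i, by omega⟩ ⟨j, by omega⟩
      have hb' := signBit_le (μ (.zig ⟨i, by omega⟩ ⟨j, by omega⟩))
      have hr := (hrow j).1
      dsimp only at hb
      rw [tableHeight, add_assoc zp, hb]
      omega
  refine ⟨hμ.isPotential (fun i j => ?_) fun j => ?_, fun i hi j hj => (hheight j hj i hi).2⟩
  · have h1 := (hheight j (by omega) i (by omega)).1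
    have hb' := signBit_le (μ (.zig i j))
    have hr := hrow j
    rw [rowDirection_mul_signBit hr.1 hr.2]
    simp only [Fin.val_succ, Fin.val_castSucc]
    rw [tableHeight, add_assoc zp, hz i j]
    omega
  · have h1 := (hcol j (by omega)).1
    have hb' := signBit_le (μ (.line 0 j))
    rw [signBit_eq]
    simp only [Fin.val_succ, Fin.val_castSucc, Fin.val_zero, tableHeight]
    rw [colHeight, hl j]
    omega

/-! ### Correctness of the program -/

theorem exists_computes_isMinFlipSequence (μ ν : P.MV) (hμ : LocallyValid μ)
    (hν : LocallyValid ν) : ∃ l : List P.Face, IsMinFlipSequence μ ν l ∧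
      RAM.ComputesWithin program (encodeInput μ ν)
        (steps P.lines ((P.lines + 1) * (P.zigzags + 1)) (P.zigzags + P.lines + 2))
        (encodeFaces l) := by
  obtain ⟨m, hm⟩ : ∃ m : ℕ → ℕ, m = fun a => (encodeInput μ ν).getD a 0 := ⟨_, rfl⟩
  obtain ⟨d, hd⟩ : ∃ d, d = if P.shift < 0 then 1 else 0 := ⟨_, rfl⟩
  obtain ⟨S, hS⟩ : ∃ S, S = P.zigzags + P.lines + 2 := ⟨_, rfl⟩
  obtain ⟨N, hN⟩ : ∃ N, N = (P.lines + 1) * (P.zigzags + 1) := ⟨_, rfl⟩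
  obtain ⟨Z, hZ⟩ : ∃ Z, Z = (P.lines + 1) * P.zigzags := ⟨_, rfl⟩
  have hzlt : ∀ (i : Fin P.zigzags) (j : Fin (P.lines + 1)), (j : ℕ) * P.zigzags + i < Z :=
    fun i j => hZ ▸ mul_add_lt (Nat.lt_succ_iff.1 j.2) i.2
  have hcr : creases P = Z + P.lines * (P.zigzags + 1) := by rw [creases, hZ]
  obtain ⟨hF, hFle⟩ := height_spec hμ m 3 (3 + Z) (4 * S) (by omega)
    (fun i j => by
      have := hzlt i j
      rw [hm]
      dsimp only
      rw [encodeInput_first _ _ (by omega), encodeMV_zig])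
    (fun j => by
      have := Nat.mul_lt_mul_of_pos_right j.2 (show 0 < P.zigzags + 1 by omega)
      rw [hm, add_assoc]
      dsimp only
      rw [encodeInput_first _ _ (by omega), hZ]
      exact encodeMV_line μ 0 j)
  obtain ⟨hG, hGle⟩ := height_spec hν m (3 + creases P) (3 + creases P + Z) (2 * S) (by omega)
    (fun i j => by
      rw [hm]
      dsimp only
      rw [encodeInput_second, encodeMV_zig])
    (fun j => by
      rw [hm, add_assoc]
      dsimp only
      rw [encodeInput_second, hZ]
      exact encodeMV_line ν 0 j)
  rw [← hd] at hF hFle hG hGle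
  obtain ⟨F, hFdef⟩ : ∃ F : ℕ → ℕ → ℕ, F = tableHeight m P.zigzags 3 (3 + Z) d (4 * S) := ⟨_, rfl⟩
  obtain ⟨G, hGdef⟩ : ∃ G : ℕ → ℕ → ℕ,
    G = tableHeight m P.zigzags (3 + creases P) (3 + creases P + Z) d (2 * S) := ⟨_, rfl⟩
  obtain ⟨t, s', hruns, ht, u, hu, hmin, φ, L, hsweep, hout⟩ := program_spec
    (RAM.start (encodeInput μ ν)) P.zigzags P.lines d Z N (creases P) S (2 * creases P + 4)
    (2 * creases P + 4 + 3 * N) (fun _ => rfl) rfl rfl rfl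
    (by rw [hd]; simp [RAM.start, encodeInput]) hZ hN hcr hS rfl rfl
    (fun a => F (a % (P.zigzags + 1)) (a / (P.zigzags + 1)))
    (fun a => G (a % (P.zigzags + 1)) (a / (P.zigzags + 1)))
    (fun a _ => by rw [hFdef, hm]; rfl) (fun a _ => by rw [hGdef, hm]; rfl)
  rw [← hFdef] at hF hFle
  rw [← hGdef] at hG hGle
  have h0 : F 0 0 = 4 * S ∧ G 0 0 = 2 * S := by
    rw [hFdef, hGdef]
    exact ⟨rfl, rfl⟩
  have hcoord : ∀ a < N, a % (P.zigzags + 1) ≤ P.zigzags ∧ a / (P.zigzags + 1) ≤ P.lines :=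
    fun a ha => ⟨Nat.lt_succ_iff.1 (Nat.mod_lt _ (by omega)), div_le_of_lt_mul (hN ▸ ha)⟩
  have hG' := hG.add_const ((2 * u : ℕ) : ℤ)
  have heven : Possible (fun v : P.Face => (F v.1 v.2 : ℤ)) (fun v => (G v.1 v.2 : ℤ))
      ((2 * u : ℕ) : ℤ) := by
    -- At the corner the difference is `4 * S - (2 * S + 2 * u)`.
    refine hF.even_sub_iff hG _ (0, 0) ⟨S - u, ?_⟩
    simp only [Fin.val_zero, h0]
    push_cast
    ring
  obtain ⟨hflip, hlen, hmem⟩ := isFlipSequence_of_sweep (μ := μ) (ν := ν) hN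
    (by simpa only [faceIndex_mod, faceIndex_div] using hF)
    (by simpa only [faceIndex_mod, faceIndex_div, Nat.cast_add] using hG')
    (by simpa only [Possible, faceIndex_mod, faceIndex_div, Nat.cast_add] using heven)
    (fun a ha => by
      have := hcoord a ha
      have := hFle _ this.1 _ this.2
      omega)
    (fun a ha => by
      have := hcoord a ha
      have := hGle _ this.1 _ this.2
      omega) hsweep
  have hsum : ∀ u : ℕ, ((∑ a ∈ Finset.range N,
      ((F (a % (P.zigzags + 1)) (a / (P.zigzags + 1)) -
        (G (a % (P.zigzags + 1)) (a / (P.zigzags + 1)) + 2 * u)) +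
      (G (a % (P.zigzags + 1)) (a / (P.zigzags + 1)) + 2 * u -
        F (a % (P.zigzags + 1)) (a / (P.zigzags + 1)))) : ℕ) : ℤ) =
      totalDiff (fun v : P.Face => (F v.1 v.2 : ℤ)) (fun v => (G v.1 v.2 : ℤ))
        ((2 * u : ℕ) : ℤ) := by
    intro u
    rw [hN, sum_range_eq_sum_face (P := P), totalDiff, Nat.cast_sum]
    refine Finset.sum_congr rfl fun v _ => ?_
    rw [faceIndex_mod, faceIndex_div]
    cases abs_cases ((F v.1 v.2 : ℤ) - (G v.1 v.2 + (2 * u : ℕ))) <;> omega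
  refine ⟨L.map (faceOf P), isMinFlipSequence_of_totalDiff hflip hF hG (0, 0) fun t ht hle => ?_,
    t, s', hruns, ?_, ?_⟩
  -- At the corner `f - g` is `2 * S`, so a translation in the window is even and lies between `0`
  -- and `4 * S`: it is one of those searched.
  · have h1 := ht (0, 0)
    simp only [Fin.val_zero, h0] at h1 hle
    rw [abs_le] at hle
    obtain ⟨r, hr⟩ := h1
    obtain ⟨u', rfl⟩ : ∃ u' : ℕ, t = ((2 * u' : ℕ) : ℤ) := ⟨(t / 2).toNat, by omega⟩
    rw [List.length_map, hlen, ← hsum u']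
    refine le_trans (le_of_eq ?_) (Int.ofNat_le.2 (hmin u' (by omega)))
    refine Eq.trans ?_ (hsum u).symm
    simp only [totalDiff, faceIndex_mod, faceIndex_div, Nat.cast_add]
  · rwa [← hN, ← hS]
  · rw [hout, encodeFaces_map (hN ▸ hmem)]

/-- The number of faces and `S` are both at most the input length, and the dominant terms of `steps`
are multiples of their product. -/
theorem steps_le (P : Miura) (n : ℕ) (hn : n = 2 * creases P + 3) :
    steps P.lines ((P.lines + 1) * (P.zigzags + 1)) (P.zigzags + P.lines + 2) ≤
      1000 * n ^ 2 + 1000 * n + 1000 := by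
  have hk := P.zigzags_pos
  have hl := P.lines_pos
  have hkl := Nat.mul_le_mul hk hl
  have h1 : P.lines + 1 ≤ n := by
    rw [hn, creases]
    nlinarith
  have h2 : (P.lines + 1) * (P.zigzags + 1) ≤ n := by
    rw [hn, creases]
    nlinarith
  have h3 : P.zigzags + P.lines + 2 ≤ n := by
    rw [hn, creases]
    nlinarith
  generalize (P.lines + 1) * (P.zigzags + 1) = N at h2 ⊢
  generalize P.zigzags + P.lines + 2 = S at h3 ⊢
  have h4 : S * N ≤ n * n := Nat.mul_le_mul h3 h2
  unfold steps
  nlinarith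

end MiuraFlip.Miura

open MiuraFlip MiuraFlip.Miura in
theorem mainTheorem3 :
    -- one program finds a minimum-length flip sequence, in time polynomial in the input length
    (∃ (prog : RAM.Prog) (T : Polynomial ℕ), ∀ (P : Miura) (μ ν : P.MV),
      LocallyValid μ → LocallyValid ν →
      ∃ l : List P.Face, IsMinFlipSequence μ ν l ∧
        RAM.ComputesWithin prog (encodeInput μ ν) (T.eval (encodeInput μ ν).length)
          (encodeFaces l)) ∧
    -- tableHeight functions exist
    (∀ (P : Miura) (μ : P.MV), LocallyValid μ → ∃ f : P.Face → ℤ, IsHeight μ f) ∧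
    -- the minimum length is half the total tableHeight difference, minimized over the possible
    -- translations, and linearly many translations suffice
    (∀ (P : Miura) (μ ν : P.MV), LocallyValid μ → LocallyValid ν →
      ∀ l : List P.Face, IsMinFlipSequence μ ν l →
      ∀ f g : P.Face → ℤ, IsHeight μ f → IsHeight ν g →
        (∀ t : ℤ, Possible f g t → 2 * (l.length : ℤ) ≤ totalDiff f g t) ∧
        ∀ v₀ : P.Face, ∃ t : ℤ, Possible f g t ∧
          |t - (f v₀ - g v₀)| ≤ 2 * (P.zigzags + P.lines : ℤ) ∧
          2 * (l.length : ℤ) = totalDiff f g t) := by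
  refine ⟨⟨RAM.MinFlip.program, 1000 * Polynomial.X ^ 2 + 1000 * Polynomial.X + 1000,
    fun P μ ν hμ hν => ?_⟩, fun P μ hμ => ?_, fun P μ ν _ _ l hl f g hf hg => ?_⟩
  · obtain ⟨l, hl, t, s, hruns, ht, hout⟩ := exists_computes_isMinFlipSequence μ ν hμ hν
    refine ⟨l, hl, t, s, hruns, ht.trans ((steps_le P _ (length_encodeInput μ ν)).trans_eq ?_),
      hout⟩
    simp
  · obtain ⟨f, hf⟩ := hμ.exists_isPotential
    exact ⟨f, (isHeight_iff μ f).2 hf⟩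
  · rw [isHeight_iff] at hf hg
    exact ⟨fun t ht => two_mul_length_le_totalDiff hl hf hg ht,
      exists_possible_totalDiff hl hf hg⟩
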